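/- **Setting.** Fix $S>0$, $\overline N\in\mathbb N$, a measurable space $\mathcal X$ and $d\in\mathbb N$. A *block* $z=(N,W,x)$ consists of a size $N<\overline N$, an adjacency matrix $W\in\{0,1\}^{N\times N}$ and covariates $x\in\mathcal X^N$. A parameter $\theta\in\mathbb R^d$ determines, for each block $z$, individual $i$ and set $C$ of individuals, a rate $\lambda_i^{+C}=\lambda_i^{+C}(\theta;z)$. The case where the parameter is itself a finite family of rates, each $\lambda_i^{+C}(\theta;z)$ being a coordinate of $\theta$, is included. *Adoption process in a block.* Nobody has adopted at time $0$. In each round the individuals $i$ who have not adopted draw independent latent partial times $T_i\sim\mathrm{Exp}(\lambda_i^{+C_i})$, where $C_i$ is the set of current adopters $j$ with $W_{ij}=1$; these draws are conditionally independent of the past given the current set of adopters. The individual with the smallest $T_i$ adopts after that elapsed time and withdraws, and the next round starts with the updated rates. One observes $z$ and $y_i=\mathbf 1\{i\text{ has adopted by time }S\}$, $i\le N$. Let $p_\theta(y\mid z)$ be the probability of $y$ under this process and $l(\theta)=\ln p_\theta(y\mid z)$ the log-likelihood of the block. Let $P_\theta$ be the law of $(z,y)$ when $z\sim\mathcal D$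 and $y\mid z\sim p_\theta(\cdot\mid z)$. **Theorem (Asymptotic normality).** Let $\Theta\subset\mathbb R^d$ be compact and $\theta_0\in\operatorname{int}\Theta$. Assume: 1. for some $0<\underline\lambda\le\overline\lambda<\infty$, $\lambda_i^{+C}(\theta;z)\in[\underline\lambda,\overline\lambda]$ for all $\theta\in\Theta$ and all $z,i,C$; the rates are measurable in $x$ and continuous in $\theta\in\Theta$; and on some neighbourhood of $\theta_0$ they are twice continuously differentiable in $\theta$, with derivatives of order up to two bounded uniformly in $(z,i,C)$ (when the rates are coordinates of $\theta$ and $\Theta\subset(0,\infty)^d$, the continuity, differentiability and bounds in this assumption hold automatically); 2. the parameter is identified: if $\theta\in\Theta$ and $P_\theta=P_{\theta_0}$, then $\theta=\theta_0$; 3. the matrix $J=\mathbb E_{\theta_0}[\partial l\,(\partial l)']$, with $\partial l=\nabla_\theta l(\theta_0)$, is nonsingular. Let the observed blocks $(z_b,y_b)$, $b=1,2,\dots$, be i.i.d. with law $P_{\theta_0}$, and for each $B$ let $\hat\theta_B$ be a (measurable) maximum likelihood estimator, i.e. almost surely a maximizer over $\Theta$ of $\sum_{b=1}^B l_b(\theta)$.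 Then the score $\partial l$ exists, the entries of $\partial l(\partial l)'$ are integrable, $J$ is positive definite, and as $B\to\infty$ $$\sqrt B\,(\hat\theta_B-\theta_0)\ \to^d\ \mathcal N\big(0,\,J^{-1}\big),\qquad J=\mathbb E[\partial l\,(\partial l)'].$$ Consequently the estimated rates are asymptotically normal: for every finite vector $\lambda(\theta)=(\lambda_{i_a}^{+C_a}(\theta;z_a))_{a\le m}$ of rates, with Jacobian $G=\partial\lambda/\partial\theta'$ at $\theta_0$, $$\sqrt B\,\big(\lambda(\hat\theta_B)-\lambda(\theta_0)\big)\ \to^d\ \mathcal N\big(0,\,G J^{-1}G'\big).$$ In particular, if the rates themselves are the parameter, $\sqrt B(\hat\lambda-\lambda)\to^d\mathcal N\big(0,\mathbb E[\partial l(\partial l)']^{-1}\big)$. -/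

import Mathlib

open MeasureTheory ProbabilityTheory Filter Topology
open scoped ENNReal

noncomputable section

namespace PeerEffects

/-- Characteristics of a block: its size `n < Nbar`, its adjacency matrix `W` (`W i j = true` iff
`j` is a neighbour of `i`), and the covariates of its members. -/
abbrev Block (Nbar : ℕ) (𝒳 : Type*) : Type _ :=
  Σ n : Fin Nbar, (Fin n → Fin n → Bool) × (Fin n → 𝒳)

/-- What is observed of a block: its characteristics and the outcomes `y i` of its members at time
`S` (`true` = has opted in). The times and the order of adoption are not observed. -/
abbrev BlockObs (Nbar : ℕ) (𝒳 : Type*) : Type _ :=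
  Σ n : Fin Nbar, ((Fin n → Fin n → Bool) × (Fin n → 𝒳)) × (Fin n → Bool)

/-- A family of rates indexed by a parameter in `P`: `rate θ z i C` is the exponential rate
`λ_i^{+C}` of individual `i` of a block with characteristics `z` once exactly the members of `C`,
among the neighbours of `i`, have opted in. -/
abbrev RateFamily (P : Type*) (Nbar : ℕ) (𝒳 : Type*) : Type _ :=
  P → (z : Block Nbar 𝒳) → Fin z.1 → Finset (Fin z.1) → ℝ

/-- A label `(z, i, C)` of one rate `λ_i^{+C}`. -/
abbrev RateIndex (Nbar : ℕ) (𝒳 : Type*) : Type _ :=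
  Σ z : Block Nbar 𝒳, Fin z.1 × Finset (Fin z.1)

/-- The continuous-time adoption process. `adoptersProb W r m A s D` is the probability that the
set of adopters is `D` when the remaining observation time `s` has elapsed, if it is `A` now and at
most `m` further rounds are played.

In a round, the individuals `i ∉ A` draw independent latent partial times
`t i ∼ Exp (r i C)`, with `C` the set of adopters connected to `i`. If all of these exceed the
remaining time `s`, the set of adopters stays `A`. Otherwise the individual `k` whose time is
smallest opts in and withdraws, and the next round starts with remaining time `s - t k`.
(Ties have probability zero.) -/
def adoptersProb {n : ℕ} (W : Fin n → Fin n → Bool) (r : Fin n → Finset (Fin n) → ℝ) :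
    ℕ → Finset (Fin n) → ℝ → Finset (Fin n) → ℝ≥0∞
  | 0, A, _, D => if D = A then 1 else 0
  | m + 1, A, s, D =>
      ∫⁻ t : {i : Fin n // i ∉ A} → ℝ,
        ((if (∀ i, s < t i) ∧ D = A then 1 else 0) +
          ∑ k : {i : Fin n // i ∉ A},
            if t k ≤ s ∧ ∀ j, j ≠ k → t k < t j
              then adoptersProb W r m (insert k.1 A) (s - t k) D else 0)
        ∂(Measure.pi fun i : {i : Fin n // i ∉ A} =>
            expMeasure (r i.1 (A.filter fun j => W i.1 j = true)))

section Model

variable {P : Type*} {Nbar : ℕ} {𝒳 : Type*}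

/-- The likelihood of a block: the probability that the process, started without adopters, gives
the outcomes `y` at time `S` (the number of rounds is at most the number of individuals). -/
def likelihood (S : ℝ) (rate : RateFamily P Nbar 𝒳) (θ : P) (z : Block Nbar 𝒳)
    (y : Fin z.1 → Bool) : ℝ≥0∞ :=
  adoptersProb z.2.1 (rate θ z) z.1 ∅ S (Finset.univ.filter fun i => y i = true)

/-- The log-likelihood `l_b` of an observed block. -/
def logLik (S : ℝ) (rate : RateFamily P Nbar 𝒳) (θ : P) (o : BlockObs Nbar 𝒳) : ℝ :=
  Real.log (likelihood S rate θ ⟨o.1, o.2.1⟩ o.2.2).toReal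

/-- The conditional law of the observation of a block given its characteristics. -/
def outcomeLaw [MeasurableSpace 𝒳] (S : ℝ) (rate : RateFamily P Nbar 𝒳) (θ : P)
    (z : Block Nbar 𝒳) : Measure (BlockObs Nbar 𝒳) :=
  ∑ y : Fin z.1 → Bool, likelihood S rate θ z y • Measure.dirac ⟨z.1, (z.2, y)⟩

/-- The law of the observation of a block whose characteristics are drawn from `𝒟`. -/
def modelLaw [MeasurableSpace 𝒳] (S : ℝ) (rate : RateFamily P Nbar 𝒳)
    (𝒟 : Measure (Block Nbar 𝒳)) (θ : P) : Measure (BlockObs Nbar 𝒳) :=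
  𝒟.bind (outcomeLaw S rate θ)

/-- `θhat` is a maximum likelihood estimate over `Θ` from the first `B` blocks of the sample. -/
def IsMLE (S : ℝ) (rate : RateFamily P Nbar 𝒳) (Θ : Set P) (sample : ℕ → BlockObs Nbar 𝒳)
    (B : ℕ) (θhat : P) : Prop :=
  θhat ∈ Θ ∧ ∀ θ ∈ Θ,
    ∑ b ∈ Finset.range B, logLik S rate θ (sample b) ≤
      ∑ b ∈ Finset.range B, logLik S rate θhat (sample b)

end Model

section Score

variable {d : ℕ} {Nbar : ℕ} {𝒳 : Type*}

/-- The score `∂l` of a block. -/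
def score (S : ℝ) (rate : RateFamily (EuclideanSpace ℝ (Fin d)) Nbar 𝒳)
    (θ : EuclideanSpace ℝ (Fin d)) (o : BlockObs Nbar 𝒳) : EuclideanSpace ℝ (Fin d) :=
  gradient (fun θ' => logLik S rate θ' o) θ

/-- The expected outer product of the score, `E[∂l (∂l)']`. -/
def scoreOuter [MeasurableSpace 𝒳] (S : ℝ)
    (rate : RateFamily (EuclideanSpace ℝ (Fin d)) Nbar 𝒳) (𝒟 : Measure (Block Nbar 𝒳))
    (θ : EuclideanSpace ℝ (Fin d)) : Matrix (Fin d) (Fin d) ℝ :=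
  Matrix.of fun i j => ∫ o, score S rate θ o i * score S rate θ o j ∂(modelLaw S rate 𝒟 θ)

/-- The Jacobian at `θ` of a finite list of rates with respect to the parameter. -/
def rateJacobian (rate : RateFamily (EuclideanSpace ℝ (Fin d)) Nbar 𝒳)
    (θ : EuclideanSpace ℝ (Fin d)) {m : ℕ} (c : Fin m → RateIndex Nbar 𝒳) :
    Matrix (Fin m) (Fin d) ℝ :=
  Matrix.of fun a j =>
    gradient (fun θ' => rate θ' (c a).1 (c a).2.1 (c a).2.2) θ j

/-- The vector of the rates in a finite list. -/
def rateVector (rate : RateFamily (EuclideanSpace ℝ (Fin d)) Nbar 𝒳)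
    (θ : EuclideanSpace ℝ (Fin d)) {m : ℕ} (c : Fin m → RateIndex Nbar 𝒳) :
    EuclideanSpace ℝ (Fin m) :=
  WithLp.toLp 2 fun a => rate θ (c a).1 (c a).2.1 (c a).2.2

end Score

end PeerEffects

end

open MeasureTheory ProbabilityTheory Filter Topology
open scoped ENNReal

noncomputable section

set_option maxSynthPendingDepth 3

namespace PeerEffects

/-! ### Competing exponential clocks. -/

section ExponentialRace

/-! The likelihood is an iterated integral over latent clocks, from which neither smoothness in the
rates nor positivity can be read off. Both come from one fact: in a race of independent exponential
clocks, the first ring and its owner have an explicit exponential law, so the set of adopters is a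
Markov jump process on the finitely many subsets of a block. The integrals collapse to an entry of a
matrix exponential (`adoptersProb_eq_ofReal_transition`), which is analytic in the rates, and
positive because every set is reached from the empty one with positive probability in any positive
time.

Covariates enter only through the rates, the rates lie in a compact box of positive numbers, and
sizes, networks and outcomes are finite in number. Hence the log-likelihood and its first two
derivatives in the rates are bounded uniformly over all blocks (`exists_bound_log_transition`), and
every integrability requirement is met by constants.

What remains is the classical argument for maximum likelihood. A uniform strong law and the strict
Kullback–Leibler inequality (`integral_logLik_lt`) give strong consistency. At an interior maximizer
the score vanishes; expanding it at `θ₀` gives mean score = -(mean Hessian)(`θhat` - `θ₀`) up to a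
relatively small error (`ae_score_expansion`). The Bartlett identities show that the mean score has
expectation zero and that the Hessian has expectation -J, the central limit theorem gives the score
the limit N(0, J), and inverting J yields J⁻¹ J J⁻¹ = J⁻¹. The delta method transfers this to the
rates. -/

lemma expMeasure_Ioi {r : ℝ} (hr : 0 < r) {u : ℝ} (hu : 0 ≤ u) :
    expMeasure r (Set.Ioi u) = ENNReal.ofReal (Real.exp (-(r * u))) := by
  have := isProbabilityMeasure_expMeasure hr
  rw [← Set.compl_Iic, prob_compl_eq_one_sub measurableSet_Iic, ← ofReal_cdf, cdf_expMeasure_eq hr,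
    if_pos hu, ← ENNReal.ofReal_one, ← ENNReal.ofReal_sub]
  · congr 1; ring
  · have : Real.exp (-(r * u)) ≤ 1 := Real.exp_le_one_iff.2 (by nlinarith)
    linarith

lemma lintegral_expMeasure (r : ℝ) {f : ℝ → ℝ≥0∞} (hf : Measurable f) :
    ∫⁻ u, f u ∂(expMeasure r) =
      ∫⁻ u in Set.Ici 0, ENNReal.ofReal (r * Real.exp (-(r * u))) * f u := by
  have h : expMeasure r = volume.withDensity (exponentialPDF r) := rfl
  have hm : Measurable (exponentialPDF r) := (measurable_exponentialPDFReal r).ennreal_ofReal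
  rw [h, lintegral_withDensity_eq_lintegral_mul _ hm hf, ← lintegral_indicator measurableSet_Ici]
  congr 1 with u
  by_cases hu : 0 ≤ u
  · simp [Set.indicator, hu, exponentialPDF_eq]
  · simp [Set.indicator, hu, exponentialPDF_eq]

variable {ι : Type*} [Fintype ι] {r : ι → ℝ}

/-- No clock rings before time `s ≥ 0`. -/
lemma pi_expMeasure_forall_lt (hr : ∀ i, 0 < r i) {s : ℝ} (hs : 0 ≤ s) :
    (Measure.pi fun i => expMeasure (r i)) {t | ∀ i, s < t i} =
      ENNReal.ofReal (Real.exp (-((∑ i, r i) * s))) := by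
  have := fun i => isProbabilityMeasure_expMeasure (hr i)
  have h : {t : ι → ℝ | ∀ i, s < t i} = Set.univ.pi fun _ => Set.Ioi s := by ext; simp
  rw [h, Measure.pi_pi]
  simp_rw [fun i => expMeasure_Ioi (hr i) hs]
  rw [← ENNReal.ofReal_prod_of_nonneg fun i _ => (Real.exp_pos _).le, ← Real.exp_sum,
    Finset.sum_neg_distrib, Finset.sum_mul]

/-- The law of the time of the first ring on the event that the clock `k` rings first. -/
lemma lintegral_first_ring [DecidableEq ι] (hr : ∀ i, 0 < r i) (k : ι) {h : ℝ → ℝ≥0∞} (hh : Measurable h) :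
    ∫⁻ t, (if ∀ j, j ≠ k → t k < t j then h (t k) else 0)
        ∂(Measure.pi fun i => expMeasure (r i)) =
      ∫⁻ u in Set.Ici 0, ENNReal.ofReal (r k * Real.exp (-((∑ i, r i) * u))) * h u := by
  have := fun i => isProbabilityMeasure_expMeasure (hr i)
  have hms : MeasurableSet {t : ι → ℝ | ∀ j, j ≠ k → t k < t j} := by
    have : {t : ι → ℝ | ∀ j, j ≠ k → t k < t j} = ⋂ j, ⋂ (_ : j ≠ k), {t | t k < t j} := by
      ext; simp
    rw [this]
    exact MeasurableSet.iInter fun j => MeasurableSet.iInter fun _ =>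
      measurableSet_lt (measurable_pi_apply k) (measurable_pi_apply j)
  have hmf : Measurable fun t : ι → ℝ => if ∀ j, j ≠ k → t k < t j then h (t k) else 0 :=
    Measurable.ite hms (hh.comp (measurable_pi_apply k)) measurable_const
  -- Fubini with clock `k` outermost: given that it rings at `u`, the others ring later with
  -- probability exp(-(sum of their rates) u). The base point 0 is immaterial, as every coordinate
  -- is integrated out.
  rw [lintegral_eq_lmarginal_univ 0, lmarginal_erase _ hmf (Finset.mem_univ k)]
  have key : ∀ u : ℝ, 0 ≤ u →
      (∫⋯∫⁻_Finset.univ.erase k, (fun t : ι → ℝ => if ∀ j, j ≠ k → t k < t j then h (t k) else 0)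
        ∂fun i => expMeasure (r i)) (Function.update 0 k u) =
      ENNReal.ofReal (Real.exp (-((∑ i ∈ Finset.univ.erase k, r i) * u))) * h u := by
    intro u hu
    have hk : ∀ y : (i : ↥(Finset.univ.erase k)) → ℝ,
        (if ∀ j, j ≠ k → Function.updateFinset (Function.update (0 : ι → ℝ) k u)
            (Finset.univ.erase k) y k < Function.updateFinset (Function.update (0 : ι → ℝ) k u)
            (Finset.univ.erase k) y j
          then h (Function.updateFinset (Function.update (0 : ι → ℝ) k u)
            (Finset.univ.erase k) y k) else 0) =
        ({y | ∀ i, u < y i} : Set (↥(Finset.univ.erase k) → ℝ)).indicator (fun _ => h u) y := by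
      intro y
      have h1 : Function.updateFinset (Function.update (0 : ι → ℝ) k u)
          (Finset.univ.erase k) y k = u := by simp [Function.updateFinset]
      rw [h1]
      have h2 : (∀ j, j ≠ k → u < Function.updateFinset (Function.update (0 : ι → ℝ) k u)
          (Finset.univ.erase k) y j) ↔ ∀ i, u < y i := by
        constructor
        · rintro H ⟨i, hi⟩
          have hik : i ≠ k := by simpa using hi
          have := H i hik
          simpa [Function.updateFinset, hik] using this
        · intro H j hj
          simpa [Function.updateFinset, hj] using H ⟨j, by simpa using hj⟩
      simp only [h2, Set.indicator, Set.mem_ofPred_eq]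
    rw [lmarginal]
    simp_rw [hk]
    rw [lintegral_indicator_const,
      pi_expMeasure_forall_lt (r := fun i : ↥(Finset.univ.erase k) => r i) (fun i => hr i) hu, mul_comm,
      Finset.sum_coe_sort (Finset.univ.erase k) r]
    have : {y : ↥(Finset.univ.erase k) → ℝ | ∀ i, u < y i} = ⋂ i, {y | u < y i} := by ext; simp
    rw [this]
    exact MeasurableSet.iInter fun i => measurableSet_lt measurable_const (measurable_pi_apply i)
  rw [lintegral_expMeasure (r k) (f := fun u => (∫⋯∫⁻_Finset.univ.erase k,
    (fun t : ι → ℝ => if ∀ j, j ≠ k → t k < t j then h (t k) else 0)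
      ∂fun i => expMeasure (r i)) (Function.update 0 k u))
    ((hmf.lmarginal _).comp (measurable_update 0))]
  refine setLIntegral_congr_fun measurableSet_Ici fun u hu => ?_
  rw [key u hu, ← mul_assoc, ← ENNReal.ofReal_mul (by have := hr k; positivity), mul_assoc,
    ← Real.exp_add]
  congr 4
  rw [← Finset.add_sum_erase _ _ (Finset.mem_univ k)]
  ring

end ExponentialRace

/-! ### The Markov jump process of adopter sets. -/

section Transition

variable {n : ℕ}

/-- The generator of the process on sets of adopters, as an operator on functions of the current
set of adopters. -/
def generator (W : Fin n → Fin n → Bool) (r : Fin n → Finset (Fin n) → ℝ) :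
    (Finset (Fin n) → ℝ) →L[ℝ] (Finset (Fin n) → ℝ) :=
  LinearMap.toContinuousLinearMap
    { toFun := fun g A => ∑ k : {i : Fin n // i ∉ A},
        r k.1 (A.filter fun j => W k.1 j = true) * (g (insert k.1 A) - g A)
      map_add' := fun g g' => by
        ext A
        simp only [Pi.add_apply, ← Finset.sum_add_distrib]
        exact Finset.sum_congr rfl fun k _ => by ring
      map_smul' := fun c g => by
        ext A
        simp only [Pi.smul_apply, smul_eq_mul, RingHom.id_apply, Finset.mul_sum]
        exact Finset.sum_congr rfl fun k _ => by ring }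

lemma generator_apply (W : Fin n → Fin n → Bool) (r : Fin n → Finset (Fin n) → ℝ)
    (g : Finset (Fin n) → ℝ) (A : Finset (Fin n)) :
    generator W r g A = ∑ k : {i : Fin n // i ∉ A},
      r k.1 (A.filter fun j => W k.1 j = true) * (g (insert k.1 A) - g A) := rfl

/-- The generator as a linear function of the rates. -/
def generatorLinear (W : Fin n → Fin n → Bool) :
    (Fin n → Finset (Fin n) → ℝ) →ₗ[ℝ]
      ((Finset (Fin n) → ℝ) →L[ℝ] (Finset (Fin n) → ℝ)) where
  toFun := generator W
  map_add' r r' := by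
    ext g A
    simp only [generator_apply, add_apply, Pi.add_apply,
      ← Finset.sum_add_distrib]
    exact Finset.sum_congr rfl fun k _ => by ring
  map_smul' c r := by
    ext g A
    simp only [generator_apply, smul_apply, Pi.smul_apply, smul_eq_mul,
      RingHom.id_apply, Finset.mul_sum]
    exact Finset.sum_congr rfl fun k _ => by ring

/-- The probability that the set of adopters is `D` at time `s` if it is `A` at time `0`. -/
def transition (W : Fin n → Fin n → Bool) (s : ℝ) (A D : Finset (Fin n))
    (r : Fin n → Finset (Fin n) → ℝ) : ℝ :=
  NormedSpace.exp (s • generator W r) (Pi.single D 1) A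

variable {W : Fin n → Fin n → Bool} {r : Fin n → Finset (Fin n) → ℝ} {A D : Finset (Fin n)}

lemma transition_zero : transition W 0 A D r = if D = A then 1 else 0 := by
  simp [transition, Pi.single_apply, eq_comm]

/-- Kolmogorov's backward equation: the generator is taken to the left of the exponential, so that
it acts on the starting set. -/
lemma hasDerivAt_transition (s : ℝ) :
    HasDerivAt (fun s => transition W s A D r)
      (∑ k : {i : Fin n // i ∉ A}, r k.1 (A.filter fun j => W k.1 j = true) *
        (transition W s (insert k.1 A) D r - transition W s A D r)) s := by
  have h := hasDerivAt_exp_smul_const' (𝕂 := ℝ) (generator W r) s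
  have h2 := ((ContinuousLinearMap.proj (R := ℝ) (φ := fun _ : Finset (Fin n) => ℝ) A).comp
    (ContinuousLinearMap.apply ℝ (Finset (Fin n) → ℝ)
      (Pi.single D 1 : Finset (Fin n) → ℝ))).hasFDerivAt.comp_hasDerivAt s h
  exact h2

lemma continuous_transition : Continuous fun s => transition W s A D r :=
  continuous_iff_continuousAt.2 fun s => (hasDerivAt_transition s).continuousAt

/-- The generator is linear in the rates and the exponential is analytic; all smoothness of the
likelihood comes from here. -/
lemma contDiff_transition (s : ℝ) {N : WithTop ℕ∞} : ContDiff ℝ N (transition W s A D) := by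
  have h1 : ContDiff ℝ N fun r => s • generator W r :=
    ((generatorLinear W).toContinuousLinearMap.contDiff).const_smul s
  have h2 : ContDiff ℝ N
      (NormedSpace.exp : ((Finset (Fin n) → ℝ) →L[ℝ] (Finset (Fin n) → ℝ)) → _) :=
    contDiff_iff_contDiffAt.2 fun x => (NormedSpace.exp_analytic (𝕂 := ℝ) x).contDiffAt
  exact ((ContinuousLinearMap.proj (R := ℝ) (φ := fun _ : Finset (Fin n) => ℝ) A).comp
    (ContinuousLinearMap.apply ℝ (Finset (Fin n) → ℝ)
      (Pi.single D 1 : Finset (Fin n) → ℝ))).contDiff.comp (h2.comp h1)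

/-- The generator kills constants, so its exponential fixes them, and the indicators of single sets
add up to the constant 1. -/
lemma sum_transition (s : ℝ) : ∑ D, transition W s A D r = 1 := by
  have h1 : ∀ s : ℝ, HasDerivAt (fun s : ℝ => NormedSpace.exp (s • generator W r) 1) 0 s := by
    intro s
    have h := hasDerivAt_exp_smul_const (𝕂 := ℝ) (generator W r) s
    have h2 := (ContinuousLinearMap.apply ℝ (Finset (Fin n) → ℝ)
      (1 : Finset (Fin n) → ℝ)).hasFDerivAt.comp_hasDerivAt s h
    refine HasDerivAt.congr_deriv h2 ?_
    have : generator W r 1 = 0 := by ext B; simp [generator_apply]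
    simp [this]
  have h2 := is_const_of_deriv_eq_zero (fun s => (h1 s).differentiableAt)
    (fun s => (h1 s).deriv) s 0
  simp only [zero_smul, NormedSpace.exp_zero, one_apply_eq_self] at h2
  have h3 : ∑ D, transition W s A D r =
      NormedSpace.exp (s • generator W r) (∑ D, Pi.single D 1) A := by
    simp [transition, map_sum, Finset.sum_apply]
  have h4 : (∑ D, Pi.single D 1 : Finset (Fin n) → ℝ) = 1 := by
    ext B; simp [Pi.single_apply]
  rw [h3, h4, h2, Pi.one_apply]

/-- First-jump decomposition, of the same shape as one round of `adoptersProb`. It integrates the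
derivative of -exp(-R u) times the transition over the remaining time s - u, in which the loss term
of the backward equation cancels against the derivative of the exponential. -/
lemma transition_eq_integral (s : ℝ) :
    transition W s A D r =
      Real.exp (-((∑ k : {i : Fin n // i ∉ A}, r k.1 (A.filter fun j => W k.1 j = true)) * s)) *
        (if D = A then 1 else 0) +
      ∫ u in (0 : ℝ)..s, ∑ k : {i : Fin n // i ∉ A}, r k.1 (A.filter fun j => W k.1 j = true) *
        Real.exp (-((∑ k : {i : Fin n // i ∉ A},
          r k.1 (A.filter fun j => W k.1 j = true)) * u)) *
        transition W (s - u) (insert k.1 A) D r := by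
  set R := ∑ k : {i : Fin n // i ∉ A}, r k.1 (A.filter fun j => W k.1 j = true) with hR
  have hd : ∀ u, HasDerivAt (fun u => -(Real.exp (-(R * u)) * transition W (s - u) A D r))
      (∑ k : {i : Fin n // i ∉ A}, r k.1 (A.filter fun j => W k.1 j = true) *
        Real.exp (-(R * u)) * transition W (s - u) (insert k.1 A) D r) u := by
    intro u
    have h1 : HasDerivAt (fun u => Real.exp (-(R * u))) (Real.exp (-(R * u)) * -(R * 1)) u :=
      (((hasDerivAt_id u).const_mul R).neg).exp
    have h2 := (hasDerivAt_transition (W := W) (A := A) (D := D) (r := r) (s - u)).comp u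
      ((hasDerivAt_id u).const_sub s)
    have h3 : ∑ k : {i : Fin n // i ∉ A}, r k.1 (A.filter fun j => W k.1 j = true) *
          Real.exp (-(R * u)) * transition W (s - u) (insert k.1 A) D r =
        Real.exp (-(R * u)) * ∑ k : {i : Fin n // i ∉ A},
          r k.1 (A.filter fun j => W k.1 j = true) * transition W (s - u) (insert k.1 A) D r := by
      rw [Finset.mul_sum]
      exact Finset.sum_congr rfl fun k _ => by ring
    refine HasDerivAt.congr_deriv (h1.mul h2).neg ?_
    simp only [mul_sub, Finset.sum_sub_distrib, ← Finset.sum_mul, Function.comp, ← hR]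
    rw [h3]
    ring
  rw [intervalIntegral.integral_eq_sub_of_hasDerivAt fun u _ => hd u]
  · simp [transition_zero]
  · refine Continuous.intervalIntegrable ?_ _ _
    refine continuous_finsetSum _ fun k _ => ?_
    exact (by fun_prop : Continuous fun u => r k.1 (A.filter fun j => W k.1 j = true) *
      Real.exp (-(R * u))).mul (continuous_transition.comp (by fun_prop))

/-- The process on sets of adopters is the Markov jump process with the given generator. -/
theorem adoptersProb_eq_ofReal_transition (hr : ∀ i C, 0 < r i C) (D : Finset (Fin n)) (m : ℕ) :
    ∀ (A : Finset (Fin n)) (s : ℝ), 0 ≤ s → n ≤ m + A.card →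
      adoptersProb W r m A s D = ENNReal.ofReal (transition W s A D r) ∧
      0 ≤ transition W s A D r ∧ (A ⊆ D → 0 < s → 0 < transition W s A D r) := by
  -- The condition `n ≤ m + A.card` says that enough rounds remain for everybody to adopt.
  -- Nonnegativity must be carried along, since `ENNReal.ofReal` commutes only with sums and
  -- integrals of nonnegative terms.
  induction m with
  | zero =>
    intro A s hs hm
    have hA : A = Finset.univ := by
      rw [← Finset.card_eq_iff_eq_univ, Fintype.card_fin]
      exact le_antisymm (by simpa using A.card_le_univ) (by simpa using hm)
    have he : IsEmpty {i : Fin n // i ∉ A} := by subst hA; exact ⟨fun k => k.2 (Finset.mem_univ _)⟩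
    rw [transition_eq_integral]
    simp only [adoptersProb, Finset.univ_eq_empty, Finset.sum_empty, zero_mul, neg_zero,
      Real.exp_zero, one_mul, intervalIntegral.integral_zero, add_zero]
    refine ⟨by split_ifs <;> simp, by split_ifs <;> simp, fun hAD _ => ?_⟩
    rw [if_pos (by rw [hA] at hAD ⊢; exact Finset.univ_subset_iff.1 hAD)]
    exact one_pos
  | succ m ih =>
    intro A s hs hm
    have ih' : ∀ (k : {i : Fin n // i ∉ A}) (u : ℝ), 0 ≤ u → _ := fun k u hu =>
      ih (insert k.1 A) u hu (by rw [Finset.card_insert_of_notMem k.2]; omega)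
    set ρ : {i : Fin n // i ∉ A} → ℝ := fun k => r k.1 (A.filter fun j => W k.1 j = true) with hρ
    have hρ0 : ∀ k, 0 < ρ k := fun k => hr _ _
    set R := ∑ k, ρ k with hR
    have hcont : ∀ k : {i : Fin n // i ∉ A}, Continuous fun u =>
        ρ k * Real.exp (-(R * u)) * transition W (s - u) (insert k.1 A) D r := fun k =>
      (by fun_prop : Continuous fun u => ρ k * Real.exp (-(R * u))).mul
        (continuous_transition.comp (by fun_prop))
    have hnn : ∀ (k : {i : Fin n // i ∉ A}) (u : ℝ), u ≤ s →
        0 ≤ ρ k * Real.exp (-(R * u)) * transition W (s - u) (insert k.1 A) D r := fun k u hu =>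
      mul_nonneg (mul_nonneg (hρ0 k).le (Real.exp_pos _).le) (ih' k _ (sub_nonneg.2 hu)).2.1
    have heq : transition W s A D r = Real.exp (-(R * s)) * (if D = A then 1 else 0) +
        ∑ k, ∫ u in (0 : ℝ)..s,
          ρ k * Real.exp (-(R * u)) * transition W (s - u) (insert k.1 A) D r := by
      rw [transition_eq_integral, intervalIntegral.integral_finsetSum]
      exact fun k _ => (hcont k).intervalIntegrable _ _
    have hint : ∀ k : {i : Fin n // i ∉ A}, 0 ≤ ∫ u in (0 : ℝ)..s,
        ρ k * Real.exp (-(R * u)) * transition W (s - u) (insert k.1 A) D r := fun k =>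
      intervalIntegral.integral_nonneg hs fun u hu => hnn k u hu.2
    have hfst : 0 ≤ Real.exp (-(R * s)) * (if D = A then 1 else 0) :=
      mul_nonneg (Real.exp_pos _).le (by split_ifs <;> simp)
    refine ⟨?_, ?_, ?_⟩
    · have := fun i => isProbabilityMeasure_expMeasure (hρ0 i)
      rw [adoptersProb, heq, ENNReal.ofReal_add hfst (Finset.sum_nonneg fun k _ => hint k),
        ENNReal.ofReal_sum_of_nonneg fun k _ => hint k]
      have hms : MeasurableSet {t : {i : Fin n // i ∉ A} → ℝ | ∀ i, s < t i} := by
        have : {t : {i : Fin n // i ∉ A} → ℝ | ∀ i, s < t i} = ⋂ i, {t | s < t i} := by ext; simp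
        rw [this]
        exact MeasurableSet.iInter fun i =>
          measurableSet_lt measurable_const (measurable_pi_apply i)
      have hstay : ∀ t : {i : Fin n // i ∉ A} → ℝ,
          (if (∀ i, s < t i) ∧ D = A then (1 : ℝ≥0∞) else 0) =
            {t : {i : Fin n // i ∉ A} → ℝ | ∀ i, s < t i}.indicator
              (fun _ => if D = A then 1 else 0) t := by
        intro t
        by_cases h1 : ∀ i, s < t i <;> by_cases h2 : D = A <;> simp [Set.indicator, h1, h2]
      have hring : ∀ (k : {i : Fin n // i ∉ A}) (t : {i : Fin n // i ∉ A} → ℝ),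
          (if t k ≤ s ∧ ∀ j, j ≠ k → t k < t j
            then adoptersProb W r m (insert k.1 A) (s - t k) D else 0) =
          if ∀ j, j ≠ k → t k < t j then (Set.Iic s).indicator
            (fun u => ENNReal.ofReal (transition W (s - u) (insert k.1 A) D r)) (t k) else 0 := by
        intro k t
        by_cases h1 : t k ≤ s
        · simp [h1, (ih' k (s - t k) (sub_nonneg.2 h1)).1]
        · simp [h1]
      have hmeas : ∀ k : {i : Fin n // i ∉ A}, Measurable ((Set.Iic s).indicator
          (fun u => ENNReal.ofReal (transition W (s - u) (insert k.1 A) D r))) := fun k =>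
        (ENNReal.measurable_ofReal.comp
          (continuous_transition.comp (by fun_prop)).measurable).indicator measurableSet_Iic
      simp_rw [hstay, hring]
      rw [lintegral_add_left (measurable_const.indicator hms), lintegral_indicator_const hms,
        pi_expMeasure_forall_lt hρ0 hs, lintegral_finsetSum']
      · congr 1
        · rw [mul_comm, ENNReal.ofReal_mul (Real.exp_pos _).le]
          congr 1
          split_ifs <;> simp
        · refine Finset.sum_congr rfl fun k _ => ?_
          rw [lintegral_first_ring hρ0 k (hmeas k),
            intervalIntegral.integral_of_le hs, ← integral_Icc_eq_integral_Ioc,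
            ofReal_integral_eq_lintegral_ofReal (hcont k).integrableOn_Icc
              ((ae_restrict_iff' measurableSet_Icc).2 (ae_of_all _ fun u hu => hnn k u hu.2)),
            ← lintegral_indicator measurableSet_Ici, ← lintegral_indicator measurableSet_Icc]
          congr 1 with u
          by_cases h0 : 0 ≤ u <;> by_cases h1 : u ≤ s <;>
            simp [Set.indicator, h0, h1]
          rw [← ENNReal.ofReal_mul (mul_nonneg (hρ0 k).le (Real.exp_pos _).le)]
      · intro k _
        refine (Measurable.ite ?_ ((hmeas k).comp (measurable_pi_apply k))
          measurable_const).aemeasurable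
        have : {t : {i : Fin n // i ∉ A} → ℝ | ∀ j, j ≠ k → t k < t j} =
            ⋂ j, ⋂ (_ : j ≠ k), {t | t k < t j} := by ext; simp
        rw [this]
        exact MeasurableSet.iInter fun j => MeasurableSet.iInter fun _ =>
          measurableSet_lt (measurable_pi_apply k) (measurable_pi_apply j)
    · rw [heq]
      exact add_nonneg hfst (Finset.sum_nonneg fun k _ => hint k)
    · intro hAD hs0
      rw [heq]
      by_cases hDA : D = A
      · rw [if_pos hDA, mul_one]
        exact add_pos_of_pos_of_nonneg (Real.exp_pos _) (Finset.sum_nonneg fun k _ => hint k)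
      -- If `D` is larger than `A`, the paths whose next adopter is some `k` in `D` but not in `A`
      -- already have positive probability.
      · obtain ⟨k, hkD, hkA⟩ := Finset.exists_of_ssubset (hAD.ssubset_of_ne (Ne.symm hDA))
        refine add_pos_of_nonneg_of_pos hfst
          (Finset.sum_pos' (fun k _ => hint k) ⟨⟨k, hkA⟩, Finset.mem_univ _, ?_⟩)
        refine intervalIntegral.intervalIntegral_pos_of_pos_on
          ((hcont ⟨k, hkA⟩).intervalIntegrable _ _) (fun u hu => ?_) hs0
        exact mul_pos (mul_pos (hρ0 _) (Real.exp_pos _))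
          ((ih' ⟨k, hkA⟩ _ (sub_nonneg.2 hu.2.le)).2.2 (Finset.insert_subset hkD hAD)
            (sub_pos.2 hu.2))

end Transition

end PeerEffects

/-! ### Uniform laws of large numbers and convergence of maximizers. -/

section UniformLaw

/-- A map into `C(K, F)` is measurable if its evaluations are. -/
lemma ContinuousMap.measurable_of_eval {α K F : Type*} [MeasurableSpace α] [MetricSpace K]
    [CompactSpace K] [NormedAddCommGroup F] [SecondCountableTopology F] [MeasurableSpace F]
    [BorelSpace F] [MeasurableSpace C(K, F)] [BorelSpace C(K, F)] {f : α → C(K, F)}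
    (hf : ∀ x, Measurable fun a => f a x) : Measurable f := by
  obtain ⟨s, hsc, hsd⟩ := TopologicalSpace.exists_countable_dense K
  have hdist : ∀ g : C(K, F), Measurable fun a => dist (f a) g := by
    intro g
    refine measurable_of_Iic fun c => ?_
    rcases lt_or_ge c 0 with hc | hc
    · have : (fun a => dist (f a) g) ⁻¹' Set.Iic c = ∅ := by
        ext a
        simpa using hc.trans_le dist_nonneg
      rw [this]
      exact MeasurableSet.empty
    -- By continuity the uniform distance is controlled on a countable dense set, so only countably
    -- many evaluations are involved.
    · have : (fun a => dist (f a) g) ⁻¹' Set.Iic c = ⋂ x ∈ s, {a | dist (f a x) (g x) ≤ c} := by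
        ext a
        simp only [Set.mem_preimage, Set.mem_Iic, Set.mem_iInter, Set.mem_ofPred_eq]
        rw [ContinuousMap.dist_le hc]
        refine ⟨fun h x _ => h x, fun h x => ?_⟩
        have hcl : IsClosed {x | dist (f a x) (g x) ≤ c} :=
          isClosed_le ((f a).continuous.dist g.continuous) continuous_const
        exact hcl.closure_subset_iff.2 (fun y hy => h y hy) (hsd x)
      rw [this]
      exact MeasurableSet.biInter hsc fun x _ =>
        measurableSet_le ((hf x).dist measurable_const) measurable_const
  refine measurable_of_isOpen fun U hU => ?_
  choose! ε hε hεU using Metric.isOpen_iff.1 hU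
  obtain ⟨T, hTc, hT⟩ := TopologicalSpace.isOpen_iUnion_countable
    (fun g : U => Metric.ball (g : C(K, F)) (ε g)) fun g => Metric.isOpen_ball
  have hU' : U = ⋃ g ∈ T, Metric.ball (g : C(K, F)) (ε g) := by
    rw [hT]
    refine Set.Subset.antisymm (fun g hg => ?_) (Set.iUnion_subset fun g => hεU g g.2)
    exact Set.mem_iUnion.2 ⟨⟨g, hg⟩, Metric.mem_ball_self (hε g hg)⟩
  rw [hU', Set.preimage_iUnion₂]
  exact MeasurableSet.biUnion hTc fun g _ => measurableSet_lt (hdist g) measurable_const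

variable {Ω α E F : Type*} [MeasurableSpace Ω] [MeasurableSpace α] [MetricSpace E]
  [NormedAddCommGroup F] [NormedSpace ℝ F] [FiniteDimensional ℝ F] [MeasurableSpace F]
  [BorelSpace F] {μ : Measure Ω} [IsProbabilityMeasure μ] {ν : Measure α}

/-- The uniform strong law of large numbers over a compact set, for a bounded family of functions
that depend continuously on the parameter. -/
theorem uniform_strong_law {D : ℕ → Ω → α} (hD : ∀ b, Measurable (D b)) (hindep : iIndepFun D μ)
    (hlaw : ∀ b, μ.map (D b) = ν) {K : Set E} (hK : IsCompact K) {f : E → α → F} {M : ℝ}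
    (hmeas : ∀ x ∈ K, Measurable (f x)) (hcont : ∀ a, ContinuousOn (fun x => f x a) K)
    (hbound : ∀ x ∈ K, ∀ a, ‖f x a‖ ≤ M) :
    ContinuousOn (fun x => ∫ a, f x a ∂ν) K ∧
    ∀ᵐ ω ∂μ, TendstoUniformlyOn (fun (B : ℕ) x => (B : ℝ)⁻¹ • ∑ b ∈ Finset.range B, f x (D b ω))
      (fun x => ∫ a, f x a ∂ν) atTop K := by
  have : CompactSpace K := isCompact_iff_compactSpace.1 hK
  have : CompleteSpace F := FiniteDimensional.complete ℝ F
  have : ProperSpace F := FiniteDimensional.proper ℝ F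
  let _ : MeasurableSpace C(K, F) := borel _
  have : BorelSpace C(K, F) := ⟨rfl⟩
  have : IsProbabilityMeasure ν := by
    rw [← hlaw 0]; exact Measure.isProbabilityMeasure_map (hD 0).aemeasurable
  -- The functions of the parameter are viewed as i.i.d. elements of the separable Banach space
  -- `C(K, F)`. Its strong law is convergence in the uniform norm, and no covering argument is
  -- needed.
  set Φ : α → C(K, F) := fun a => ⟨fun x => f x a, (hcont a).domRestrict⟩ with hΦ
  have hΦm : Measurable Φ := ContinuousMap.measurable_of_eval fun x => hmeas x x.2
  have hΦi : Integrable Φ ν := by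
    refine Integrable.of_bound hΦm.aestronglyMeasurable (max M 0) (ae_of_all _ fun a => ?_)
    rw [ContinuousMap.norm_le _ (le_max_right _ _)]
    exact fun x => (hbound x x.2 a).trans (le_max_left _ _)
  have hmean : ∀ x : K, (∫ a, Φ a ∂ν) x = ∫ a, f x a ∂ν := fun x =>
    ContinuousMap.integral_apply hΦi x
  refine ⟨continuousOn_iff_continuous_domRestrict.2 ?_, ?_⟩
  · have : K.domRestrict (fun x => ∫ a, f x a ∂ν) = ⇑(∫ a, Φ a ∂ν) := by
      ext x; exact (hmean x).symm
    rw [this]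
    exact (∫ a, Φ a ∂ν).continuous
  · have hid : ∀ b, IdentDistrib (D b) (D 0) μ μ := fun b =>
      ⟨(hD b).aemeasurable, (hD 0).aemeasurable, by rw [hlaw, hlaw]⟩
    have hsl := strong_law_ae (μ := μ) (fun b ω => Φ (D b ω))
      ((hlaw 0 ▸ hΦi).comp_measurable (hD 0))
      (fun i j hij => (hindep.indepFun hij).comp hΦm hΦm)
      (fun b => (hid b).comp hΦm)
    have hm : ∫ ω, Φ (D 0 ω) ∂μ = ∫ a, Φ a ∂ν := by
      rw [← hlaw 0, integral_map (hD 0).aemeasurable hΦm.aestronglyMeasurable]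
    filter_upwards [hsl] with ω hω
    rw [hm, ContinuousMap.tendsto_iff_tendstoUniformly] at hω
    rw [tendstoUniformlyOn_iff_tendstoUniformly_comp_coe]
    convert! hω using 1
    · ext B x
      simp [hΦ]
      rfl
    · ext x
      exact (hmean x).symm

/-- Maximizers of functions that converge uniformly on a compact set converge to the maximizer of
the limit, if it is unique. -/
lemma tendsto_maximizer {K : Set E} (hK : IsCompact K) {f : ℕ → E → ℝ} {g : E → ℝ} {x₀ : E}
    (hx₀ : x₀ ∈ K) (hg : ContinuousOn g K) (hmax : ∀ x ∈ K, x ≠ x₀ → g x < g x₀)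
    (hfg : TendstoUniformlyOn f g atTop K) {x : ℕ → E} (hx : ∀ n, x n ∈ K)
    (hfx : ∀ n, f n x₀ ≤ f n (x n)) : Tendsto x atTop (𝓝 x₀) := by
  rw [tendsto_nhds]
  intro U hU hxU
  rcases (K \ U).eq_empty_or_nonempty with h | h
  · exact Eventually.of_forall fun n => Set.sdiff_eq_empty.1 h (hx n)
  · obtain ⟨y, hy, hyg⟩ := (hK.diff hU).exists_isMaxOn h (hg.mono Set.sdiff_subset)
    have hlt : g y < g x₀ := hmax y hy.1 fun he => hy.2 (he ▸ hxU)
    -- Half of the gap is the tolerance, since the uniform error is spent twice: at `x₀` and at `x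
    -- n`.
    filter_upwards [Metric.tendstoUniformlyOn_iff.1 hfg ((g x₀ - g y) / 2) (by linarith)] with n hn
    by_contra hxn
    have h1 := abs_lt.1 (hn x₀ hx₀)
    have h2 := abs_lt.1 (hn (x n) (hx n))
    have h3 : g (x n) ≤ g y := hyg ⟨hx n, hxn⟩
    have h4 := hfx n
    linarith [h1.1, h1.2, h2.1, h2.2]

end UniformLaw

/-! ### Slutsky's theorem for pathwise linear approximations. -/

section Distribution

variable {Ω Ω' E F : Type*} [MeasurableSpace Ω] [MeasurableSpace Ω'] {μ : Measure Ω}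
  [IsProbabilityMeasure μ] {μ' : Measure Ω'} [IsProbabilityMeasure μ']
  [NormedAddCommGroup E] [NormedSpace ℝ E] [SecondCountableTopology E] [MeasurableSpace E]
  [BorelSpace E]
  [NormedAddCommGroup F] [NormedSpace ℝ F] [SecondCountableTopology F] [MeasurableSpace F]
  [BorelSpace F]

/-- If `Y n` is asymptotically a linear function of `X n`, up to an error that is almost surely of
smaller order than `X n`, then it inherits the convergence in distribution. -/
theorem MeasureTheory.TendstoInDistribution.of_linear_approx {X : ℕ → Ω → E} {Y : ℕ → Ω → F} {Z : Ω' → E}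
    (hX : TendstoInDistribution X atTop Z (fun _ => μ) μ') (hY : ∀ n, AEMeasurable (Y n) μ)
    (L : E →L[ℝ] F)
    (h : ∀ᵐ ω ∂μ, ∀ ε > 0, ∀ᶠ n in atTop, ‖Y n ω - L (X n ω)‖ ≤ ε * ‖X n ω‖) :
    TendstoInDistribution Y atTop (L ∘ Z) (fun _ => μ) μ' := by
  have hXm := hX.forall_aemeasurable
  -- The relative error tends to 0 almost surely, so it can be joined to `X n` by Slutsky, and L x +
  -- ‖x‖ v rebuilds `Y n`. Where `X n` vanishes, `V n` is 0 because 0⁻¹ = 0, and the hypothesis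
  -- eventually forces `Y n` to vanish too.
  set V : ℕ → Ω → F := fun n ω => ‖X n ω‖⁻¹ • (Y n ω - L (X n ω)) with hV
  have hVm : ∀ n, AEMeasurable (V n) μ := fun n =>
    (hXm n).norm.inv.smul ((hY n).sub (L.continuous.measurable.comp_aemeasurable (hXm n)))
  have hV0 : ∀ᵐ ω ∂μ, Tendsto (fun n => V n ω) atTop (𝓝 0) := by
    filter_upwards [h] with ω hω
    rw [Metric.tendsto_nhds]
    intro ε hε
    filter_upwards [hω (ε / 2) (half_pos hε)] with n hn
    rw [dist_zero_right, hV, norm_smul, norm_inv, norm_norm, inv_mul_eq_div]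
    exact lt_of_le_of_lt (div_le_of_le_mul₀ (norm_nonneg _) (half_pos hε).le hn)
      (half_lt_self hε)
  have hcomb := hX.continuous_comp_prodMk_of_tendstoInMeasure_const
    (g := fun p : E × F => L p.1 + ‖p.1‖ • p.2) (by fun_prop)
    (tendstoInMeasure_of_tendsto_ae (fun n => (hVm n).aestronglyMeasurable) hV0) hVm
  have hcm := hcomb.forall_aemeasurable
  refine tendstoInDistribution_of_tendstoInMeasure_sub Y (L ∘ Z)
    (hcomb.congr (fun _ => EventuallyEq.rfl) (ae_of_all _ fun ω => by simp)) ?_ hY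
  refine tendstoInMeasure_of_tendsto_ae
    (fun n => ((hY n).sub (hcm n)).aestronglyMeasurable) ?_
  filter_upwards [h] with ω hω
  refine tendsto_const_nhds.congr' ?_
  filter_upwards [hω 1 one_pos] with n hn
  rcases eq_or_ne (X n ω) 0 with h0 | h0
  · have : Y n ω = 0 := by simpa [h0] using hn
    simp [h0, this]
  · have : ‖X n ω‖ ≠ 0 := norm_ne_zero_iff.2 h0
    simp [hV, smul_smul, mul_inv_cancel₀ this]

end Distribution

/-! ### Gaussian limits: linear images and the multivariate central limit theorem. -/

section Gaussian

open scoped RealInnerProductSpace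

lemma EuclideanSpace.real_inner_eq_dotProduct {d : ℕ} (x y : EuclideanSpace ℝ (Fin d)) :
    ⟪x, y⟫ = x.ofLp ⬝ᵥ y.ofLp := by
  rw [EuclideanSpace.inner_eq_star_dotProduct, dotProduct_comm]
  simp

/-- The Cramér–Wold device: it reduces the multivariate central limit theorem to the scalar one
along each direction `t`. -/
lemma charFun_map_inner_one {Ω E : Type*} [MeasurableSpace Ω] {μ : Measure Ω}
    [NormedAddCommGroup E] [InnerProductSpace ℝ E] [SecondCountableTopology E]
    [MeasurableSpace E] [BorelSpace E] {X : Ω → E} (hX : AEMeasurable X μ) (t : E) :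
    charFun (μ.map X) t = charFun (μ.map fun ω => ⟪X ω, t⟫) 1 := by
  have h1 : AEMeasurable (fun ω => ⟪X ω, t⟫) μ := hX.inner aemeasurable_const
  rw [charFun_apply, charFun_apply, integral_map hX (by fun_prop), integral_map h1 (by fun_prop)]
  simp

/-- The image of a centered Gaussian measure under a linear map. -/
lemma map_multivariateGaussian_zero {d m : ℕ} {S : Matrix (Fin d) (Fin d) ℝ} (hS : S.PosSemidef)
    (A : Matrix (Fin m) (Fin d) ℝ)
    (L : EuclideanSpace ℝ (Fin d) →L[ℝ] EuclideanSpace ℝ (Fin m))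
    (hL : ∀ x, (L x).ofLp = A.mulVec x.ofLp) :
    (multivariateGaussian 0 S).map L = multivariateGaussian 0 (A * S * A.transpose) := by
  have hS' : (A * S * A.transpose).PosSemidef := by
    simpa using hS.mul_mul_conjTranspose_same A
  have := Measure.isProbabilityMeasure_map (μ := multivariateGaussian 0 S)
    L.continuous.measurable.aemeasurable
  refine Measure.ext_of_charFun ?_
  ext t
  set u : EuclideanSpace ℝ (Fin d) := WithLp.toLp 2 (A.transpose.mulVec t.ofLp) with hu
  have hin : ∀ x, ⟪L x, t⟫ = ⟪x, u⟫ := by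
    intro x
    rw [EuclideanSpace.real_inner_eq_dotProduct, EuclideanSpace.real_inner_eq_dotProduct, hL, hu,
      Matrix.dotProduct_mulVec, Matrix.vecMul_transpose]
  have h1 : charFun ((multivariateGaussian 0 S).map L) t = charFun (multivariateGaussian 0 S) u := by
    rw [charFun_apply, charFun_apply,
      integral_map L.continuous.measurable.aemeasurable (by fun_prop)]
    simp_rw [hin]
  rw [h1, charFun_multivariateGaussian hS, charFun_multivariateGaussian hS']
  simp only [inner_zero_right, Complex.ofReal_zero, zero_mul, zero_sub]
  congr 4
  rw [← Matrix.mulVec_mulVec, ← Matrix.mulVec_mulVec, Matrix.dotProduct_mulVec t.ofLp A,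
    ← Matrix.mulVec_transpose A]

variable {Ω : Type*} [MeasurableSpace Ω] {μ : Measure Ω} [IsProbabilityMeasure μ]

/-- Only the law of the limit matters, so the limit variable can be traded for the identity on a
named measure. -/
lemma MeasureTheory.TendstoInDistribution.of_map_eq {Ω' E : Type*} [MeasurableSpace Ω'] {μ' : Measure Ω'}
    [IsProbabilityMeasure μ'] [TopologicalSpace E] [MeasurableSpace E] [BorelSpace E]
    {X : ℕ → Ω → E} {Z : Ω' → E} (h : TendstoInDistribution X atTop Z (fun _ => μ) μ')
    {ρ : Measure E} [IsProbabilityMeasure ρ] (hρ : μ'.map Z = ρ) :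
    TendstoInDistribution X atTop id (fun _ => μ) ρ where
  forall_aemeasurable := h.forall_aemeasurable
  aemeasurable_limit := aemeasurable_id
  tendsto := by
    convert! h.tendsto using 3
    simp [hρ]

/-- The multivariate central limit theorem. -/
theorem tendstoInDistribution_multivariateGaussian {d : ℕ} {X : ℕ → Ω → EuclideanSpace ℝ (Fin d)}
    (hX : MemLp (X 0) 2 μ) (hindep : iIndepFun X μ)
    (hident : ∀ b, IdentDistrib (X b) (X 0) μ μ) {J : Matrix (Fin d) (Fin d) ℝ}
    (hJ : J.PosSemidef) (hmean : ∀ t, ∫ ω, ⟪X 0 ω, t⟫ ∂μ = 0)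
    (hcov : ∀ t, ∫ ω, ⟪X 0 ω, t⟫ ^ 2 ∂μ = t.ofLp ⬝ᵥ J.mulVec t.ofLp) :
    TendstoInDistribution (fun (n : ℕ) ω => (√(n : ℝ))⁻¹ • ∑ b ∈ Finset.range n, X b ω) atTop id
      (fun _ => μ) (multivariateGaussian 0 J) where
  forall_aemeasurable n := by
    have h := Finset.aemeasurable_fun_sum (Finset.range n) (f := X)
      fun b _ => (hident b).aemeasurable_fst
    exact h.const_smul (√(n : ℝ))⁻¹
  aemeasurable_limit := aemeasurable_id
  tendsto := by
    have hm : ∀ n : ℕ, AEMeasurable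
        (fun ω => (√(n : ℝ))⁻¹ • ∑ b ∈ Finset.range n, X b ω) μ := fun n => by
      have h := Finset.aemeasurable_fun_sum (Finset.range n) (f := X)
        fun b _ => (hident b).aemeasurable_fst
      exact h.const_smul (√(n : ℝ))⁻¹
    refine ProbabilityMeasure.tendsto_iff_tendsto_charFun.2 fun t => ?_
    have hmt : Measurable fun x : EuclideanSpace ℝ (Fin d) => ⟪x, t⟫ := by fun_prop
    have hL2 : MemLp (fun ω => ⟪X 0 ω, t⟫) 2 μ := hX.inner_const t
    have hvar : Var[fun ω => ⟪X 0 ω, t⟫; μ] = t.ofLp ⬝ᵥ J.mulVec t.ofLp := by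
      rw [variance_of_integral_eq_zero hL2.aemeasurable (hmean t)]
      exact hcov t
    have hclt := tendstoInDistribution_inv_sqrt_mul_sum_sub (P := μ)
      (P' := gaussianReal 0 Var[fun ω => ⟪X 0 ω, t⟫; μ].toNNReal) (Y := id)
      (X := fun b ω => ⟪X b ω, t⟫) ⟨aemeasurable_id, by simp⟩ hL2
      (hindep.comp (fun _ x => ⟪x, t⟫) fun _ => hmt) (fun b => (hident b).comp hmt)
    have h1 := ProbabilityMeasure.tendsto_iff_tendsto_charFun.1 hclt.tendsto 1
    simp only [ProbabilityMeasure.coe_mk, Measure.map_id, charFun_gaussianReal, hmean, mul_zero,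
      sub_zero] at h1
    simp only [ProbabilityMeasure.coe_mk, Measure.map_id, charFun_multivariateGaussian hJ]
    simp_rw [charFun_map_inner_one (hm _) t]
    convert! h1 using 2
    · congr 2
      ext ω
      rw [real_inner_smul_left, sum_inner]
    · rw [hvar, Real.coe_toNNReal _ (hvar ▸ variance_nonneg _ _)]
      simp

end Gaussian

/-! ### Measurability of derivatives in a parameter. -/

section ParametricDerivative

lemma measurable_continuousLinearMap_of_apply {α E F : Type*} [MeasurableSpace α]
    [NormedAddCommGroup E] [NormedSpace ℝ E] [FiniteDimensional ℝ E] [NormedAddCommGroup F]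
    [NormedSpace ℝ F] [FiniteDimensional ℝ F] [MeasurableSpace F] [BorelSpace F]
    [MeasurableSpace (E →L[ℝ] F)] [BorelSpace (E →L[ℝ] F)] {f : α → E →L[ℝ] F}
    (hf : ∀ v, Measurable fun a => f a v) : Measurable f := by
  have : ProperSpace (E →L[ℝ] F) := FiniteDimensional.proper ℝ _
  set b := Module.finBasis ℝ E
  have h : f = fun a => ∑ i, ContinuousLinearMap.smulRightL ℝ E F
      (LinearMap.toContinuousLinearMap (b.coord i)) (f a (b i)) := by
    ext a v
    conv_lhs => rw [← b.sum_repr v, map_sum]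
    simp
  rw [h]
  exact Finset.measurable_fun_sum _ fun i _ =>
    (ContinuousLinearMap.continuous _).measurable.comp (hf (b i))

/-- Each directional derivative is a limit of difference quotients with steps `v / n`. The index is
shifted so that all the points used lie where `f` is known to be measurable. -/
lemma measurable_fderiv_of_eventually {α E F : Type*} [MeasurableSpace α]
    [NormedAddCommGroup E] [NormedSpace ℝ E] [FiniteDimensional ℝ E] [NormedAddCommGroup F]
    [NormedSpace ℝ F] [FiniteDimensional ℝ F] [MeasurableSpace F] [BorelSpace F]
    [MeasurableSpace (E →L[ℝ] F)] [BorelSpace (E →L[ℝ] F)] {f : E → α → F} {x : E}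
    (hm : ∀ᶠ y in 𝓝 x, Measurable (f y)) (hd : ∀ a, DifferentiableAt ℝ (fun y => f y a) x) :
    Measurable fun a => fderiv ℝ (fun y => f y a) x := by
  refine measurable_continuousLinearMap_of_apply fun v => ?_
  have : ProperSpace F := FiniteDimensional.proper ℝ F
  have hc : Tendsto (fun n : ℕ => x + ((n : ℝ))⁻¹ • v) atTop (𝓝 x) := by
    have := (tendsto_inv_atTop_zero.comp (tendsto_natCast_atTop_atTop (R := ℝ))).smul_const v
    simpa using this.const_add x
  obtain ⟨N, hN⟩ := eventually_atTop.1 (hc.eventually hm)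
  refine measurable_of_tendsto_metrizable
    (f := fun n a => ((n + N : ℕ) : ℝ) • (f (x + (((n + N : ℕ) : ℝ))⁻¹ • v) a - f x a))
    (fun n => ((hN (n + N) (Nat.le_add_left _ _)).sub hm.self_of_nhds).const_smul _) ?_
  rw [tendsto_pi_nhds]
  intro a
  refine (hd a).hasFDerivAt.lim v ?_
  simp only [norm_natCast]
  exact tendsto_natCast_atTop_atTop.comp (tendsto_add_atTop_nat N)

end ParametricDerivative

/-! ### Consistency and asymptotic normality of maximum likelihood. -/

section MaximumLikelihood

open scoped RealInnerProductSpace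

variable {Ω α : Type*} [MeasurableSpace Ω] [MeasurableSpace α] {μ : Measure Ω}
  [IsProbabilityMeasure μ] {ν : Measure α} {d : ℕ}

/-- The quadratic form of a second moment matrix. -/
lemma integral_inner_mul_inner {g : α → EuclideanSpace ℝ (Fin d)}
    (hg : ∀ i j, Integrable (fun a => g a i * g a j) ν) {J : Matrix (Fin d) (Fin d) ℝ}
    (hJ : ∀ i j, J i j = ∫ a, g a i * g a j ∂ν) (v w : EuclideanSpace ℝ (Fin d)) :
    ∫ a, ⟪g a, v⟫ * ⟪g a, w⟫ ∂ν = v.ofLp ⬝ᵥ J.mulVec w.ofLp := by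
  have h : ∀ a, ⟪g a, v⟫ * ⟪g a, w⟫ = ∑ i, ∑ j, v i * (w j * (g a i * g a j)) := by
    intro a
    rw [EuclideanSpace.real_inner_eq_dotProduct, EuclideanSpace.real_inner_eq_dotProduct,
      dotProduct, dotProduct, Finset.sum_mul_sum]
    exact Finset.sum_congr rfl fun i _ => Finset.sum_congr rfl fun j _ => by ring
  simp_rw [h]
  rw [integral_finsetSum _ fun i _ => integrable_finsetSum _ fun j _ =>
    ((hg i j).const_mul _).const_mul _]
  refine Finset.sum_congr rfl fun i _ => ?_
  rw [integral_finsetSum _ fun j _ => ((hg i j).const_mul _).const_mul _, Matrix.mulVec, dotProduct,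
    Finset.mul_sum]
  refine Finset.sum_congr rfl fun j _ => ?_
  rw [integral_const_mul, integral_const_mul, hJ]
  ring

/-- A nonsingular second moment matrix is positive definite. -/
lemma posDef_of_integral_mul {g : α → EuclideanSpace ℝ (Fin d)}
    (hg : ∀ i j, Integrable (fun a => g a i * g a j) ν) {J : Matrix (Fin d) (Fin d) ℝ}
    (hJ : ∀ i j, J i j = ∫ a, g a i * g a j ∂ν) (hdet : IsUnit J.det) : J.PosDef := by
  have hpsd : J.PosSemidef := by
    refine Matrix.PosSemidef.of_dotProduct_mulVec_nonneg ?_ fun x => ?_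
    · ext i j
      simp [hJ, mul_comm]
    · have := integral_inner_mul_inner hg hJ (WithLp.toLp 2 x) (WithLp.toLp 2 x)
      simp only [star_trivial]
      rw [← this]
      exact integral_nonneg fun a => mul_self_nonneg _
  exact hpsd.posDef_iff_isUnit.2 ((Matrix.isUnit_iff_isUnit_det J).2 hdet)

/-- If `s` is close to `T h`, then `h` is close to the image of `s` under a left inverse of `T`. -/
lemma norm_sub_apply_le_of_approx {E : Type*} [NormedAddCommGroup E] [NormedSpace ℝ E]
    {L T : E →L[ℝ] E} (hLT : ∀ x, L (T x) = x) {c ε ε' : ℝ} (hLc : ‖L‖ ≤ c) (hc0 : 0 < c)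
    (hε' : 0 ≤ ε') (h1 : c * ε' ≤ 1 / 2) (h2 : 2 * c ^ 2 * ε' ≤ ε) {s h : E}
    (hst : ‖s - T h‖ ≤ ε' * ‖h‖) : ‖h - L s‖ ≤ ε * ‖s‖ := by
  have hhL : ‖h - L s‖ ≤ c * (ε' * ‖h‖) := by
    have : h - L s = -L (s - T h) := by rw [map_sub, hLT, neg_sub]
    rw [this, norm_neg]
    exact (L.le_opNorm _).trans (mul_le_mul hLc hst (norm_nonneg _) hc0.le)
  have hLs : ‖L s‖ ≤ c * ‖s‖ :=
    (L.le_opNorm _).trans (mul_le_mul_of_nonneg_right hLc (norm_nonneg _))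
  have h3 : ‖h‖ ≤ ‖h - L s‖ + ‖L s‖ := by simpa using norm_add_le (h - L s) (L s)
  -- As `c * ε' ≤ 1 / 2`, the error is at most half of ‖h‖ and is absorbed on the left.
  have h4 : ‖h‖ ≤ 2 * (c * ‖s‖) := by
    have := mul_le_mul_of_nonneg_right h1 (norm_nonneg h)
    linarith
  calc ‖h - L s‖ ≤ c * ε' * ‖h‖ := by linarith
    _ ≤ c * ε' * (2 * (c * ‖s‖)) := mul_le_mul_of_nonneg_left h4 (by positivity)
    _ = 2 * c ^ 2 * ε' * ‖s‖ := by ring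
    _ ≤ ε * ‖s‖ := mul_le_mul_of_nonneg_right h2 (norm_nonneg _)

variable {l : EuclideanSpace ℝ (Fin d) → α → ℝ} {Θ V : Set (EuclideanSpace ℝ (Fin d))}
  {θ₀ : EuclideanSpace ℝ (Fin d)} {M : ℝ}

/-- Strong consistency of the maximum likelihood estimator. -/
theorem ae_tendsto_maximum_likelihood (hΘ : IsCompact Θ) (hθ₀ : θ₀ ∈ Θ)
    (hmeas : ∀ θ ∈ Θ, Measurable (l θ)) (hcont : ∀ a, ContinuousOn (fun θ => l θ a) Θ)
    (hbound : ∀ θ ∈ Θ, ∀ a, ‖l θ a‖ ≤ M)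
    (hmax : ∀ θ ∈ Θ, θ ≠ θ₀ → ∫ a, l θ a ∂ν < ∫ a, l θ₀ a ∂ν)
    {D : ℕ → Ω → α} (hD : ∀ b, Measurable (D b)) (hindep : iIndepFun D μ)
    (hlaw : ∀ b, μ.map (D b) = ν) {θhat : ℕ → Ω → EuclideanSpace ℝ (Fin d)}
    (hMLE : ∀ B, ∀ᵐ ω ∂μ, θhat B ω ∈ Θ ∧ ∀ θ ∈ Θ,
      ∑ b ∈ Finset.range B, l θ (D b ω) ≤ ∑ b ∈ Finset.range B, l (θhat B ω) (D b ω)) :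
    ∀ᵐ ω ∂μ, Tendsto (fun B => θhat B ω) atTop (𝓝 θ₀) := by
  obtain ⟨hg, hunif⟩ := uniform_strong_law hD hindep hlaw hΘ hmeas hcont hbound
  filter_upwards [hunif, ae_all_iff.2 hMLE] with ω hω hml
  refine tendsto_maximizer hΘ hθ₀ hg hmax hω (fun B => (hml B).1) fun B => ?_
  exact mul_le_mul_of_nonneg_left ((hml B).2 θ₀ hθ₀) (by positivity)

/-- The linearization of the likelihood equation. -/
theorem ae_score_expansion (hθ₀ : θ₀ ∈ interior Θ) (hmeas : ∀ θ ∈ Θ, Measurable (l θ))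
    (hV : V ∈ 𝓝 θ₀) (hC2 : ∀ θ ∈ V, ∀ a, ContDiffAt ℝ 2 (fun θ => l θ a) θ)
    (hd2 : ∀ θ ∈ V, ∀ a, ‖fderiv ℝ (fderiv ℝ fun θ => l θ a) θ‖ ≤ M)
    {D : ℕ → Ω → α} (hD : ∀ b, Measurable (D b)) (hindep : iIndepFun D μ)
    (hlaw : ∀ b, μ.map (D b) = ν) {θhat : ℕ → Ω → EuclideanSpace ℝ (Fin d)}
    (hMLE : ∀ B, ∀ᵐ ω ∂μ, θhat B ω ∈ Θ ∧ ∀ θ ∈ Θ,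
      ∑ b ∈ Finset.range B, l θ (D b ω) ≤ ∑ b ∈ Finset.range B, l (θhat B ω) (D b ω))
    (hcons : ∀ᵐ ω ∂μ, Tendsto (fun B => θhat B ω) atTop (𝓝 θ₀)) :
    Integrable (fun a => fderiv ℝ (fderiv ℝ fun θ => l θ a) θ₀) ν ∧
    ∀ᵐ ω ∂μ, ∀ ε > 0, ∀ᶠ B : ℕ in atTop,
      ‖(B : ℝ)⁻¹ • (∑ b ∈ Finset.range B, fderiv ℝ (fun θ => l θ (D b ω)) θ₀) +
        (∫ a, fderiv ℝ (fderiv ℝ fun θ => l θ a) θ₀ ∂ν) (θhat B ω - θ₀)‖ ≤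
          ε * ‖θhat B ω - θ₀‖ := by
  have : ProperSpace (EuclideanSpace ℝ (Fin d) →L[ℝ] EuclideanSpace ℝ (Fin d) →L[ℝ] ℝ) :=
    FiniteDimensional.proper ℝ _
  have : IsProbabilityMeasure ν := by
    rw [← hlaw 0]; exact Measure.isProbabilityMeasure_map (hD 0).aemeasurable
  let _ : MeasurableSpace (EuclideanSpace ℝ (Fin d) →L[ℝ] EuclideanSpace ℝ (Fin d) →L[ℝ] ℝ) :=
    borel _
  have : BorelSpace (EuclideanSpace ℝ (Fin d) →L[ℝ] EuclideanSpace ℝ (Fin d) →L[ℝ] ℝ) := ⟨rfl⟩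
  obtain ⟨δ, hδ, hδV⟩ := Metric.mem_nhds_iff.1
    (inter_mem hV (isOpen_interior.mem_nhds hθ₀))
  have hball : ∀ {θ}, θ ∈ Metric.ball θ₀ δ → θ ∈ V ∧ θ ∈ interior Θ := fun h => hδV h
  -- The uniform law needs a compact set; the larger open ball leaves room around each of its points
  -- to differentiate and to take difference quotients.
  set K := Metric.closedBall θ₀ (δ / 2) with hK
  have hKball : K ⊆ Metric.ball θ₀ δ := Metric.closedBall_subset_ball (half_lt_self hδ)
  have hdiff : ∀ θ ∈ Metric.ball θ₀ δ, ∀ a, DifferentiableAt ℝ (fun θ => l θ a) θ := fun θ hθ a =>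
    (hC2 θ (hball hθ).1 a).differentiableAt (by norm_num)
  have hC1 : ∀ θ ∈ Metric.ball θ₀ δ, ∀ a, ContDiffAt ℝ 1 (fderiv ℝ fun θ => l θ a) θ :=
    fun θ hθ a => (hC2 θ (hball hθ).1 a).fderiv_right (by norm_num)
  have hdiff2 : ∀ θ ∈ Metric.ball θ₀ δ, ∀ a,
      DifferentiableAt ℝ (fderiv ℝ fun θ => l θ a) θ := fun θ hθ a =>
    (hC1 θ hθ a).differentiableAt one_ne_zero
  have hm1 : ∀ θ ∈ Metric.ball θ₀ δ, Measurable fun a => fderiv ℝ (fun θ => l θ a) θ := by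
    intro θ hθ
    refine measurable_fderiv_of_eventually ?_ (hdiff θ hθ)
    filter_upwards [isOpen_interior.mem_nhds (hball hθ).2] with y hy
    exact hmeas y (interior_subset hy)
  have hm2 : ∀ θ ∈ K, Measurable fun a => fderiv ℝ (fderiv ℝ fun θ => l θ a) θ := by
    intro θ hθ
    refine measurable_fderiv_of_eventually (f := fun θ a => fderiv ℝ (fun θ => l θ a) θ) ?_
      (hdiff2 θ (hKball hθ))
    filter_upwards [Metric.isOpen_ball.mem_nhds (hKball hθ)] with y hy
    exact hm1 y hy
  obtain ⟨hg, hunif⟩ := uniform_strong_law hD hindep hlaw (isCompact_closedBall θ₀ (δ / 2))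
    (f := fun θ a => fderiv ℝ (fderiv ℝ fun θ => l θ a) θ) hm2
    (fun a θ hθ => ((hC1 θ (hKball hθ) a).continuousAt_fderiv one_ne_zero).continuousWithinAt)
    (fun θ hθ a => hd2 θ (hball (hKball hθ)).1 a)
  have hθ₀K : θ₀ ∈ K := Metric.mem_closedBall_self (half_pos hδ).le
  refine ⟨Integrable.of_bound (hm2 θ₀ hθ₀K).aestronglyMeasurable M
    (ae_of_all _ (hd2 θ₀ (hball (hKball hθ₀K)).1)), ?_⟩
  filter_upwards [hunif, ae_all_iff.2 hMLE, hcons] with ω hω hml hco ε hε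
  set H := fun θ => ∫ a, fderiv ℝ (fderiv ℝ fun θ => l θ a) θ ∂ν with hH
  obtain ⟨η, hη, hηH⟩ := Metric.continuousOn_iff.1 hg θ₀ hθ₀K (ε / 2) (half_pos hε)
  have hsmall : ∀ᶠ B in atTop, θhat B ω ∈ Metric.ball θ₀ (min η (δ / 2)) :=
    hco.eventually (Metric.ball_mem_nhds _ (lt_min hη (half_pos hδ)))
  filter_upwards [hsmall, Metric.tendstoUniformlyOn_iff.1 hω (ε / 2) (half_pos hε)] with B hB hBu
  have hsub : Metric.ball θ₀ (min η (δ / 2)) ⊆ K :=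
    (Metric.ball_subset_ball (min_le_right _ _)).trans Metric.ball_subset_closedBall
  set Ψ := fun θ => (B : ℝ)⁻¹ • ∑ b ∈ Finset.range B, fderiv ℝ (fun θ => l θ (D b ω)) θ with hΨ
  have hΨ' : ∀ θ ∈ Metric.ball θ₀ (min η (δ / 2)), HasFDerivWithinAt Ψ
      ((B : ℝ)⁻¹ • ∑ b ∈ Finset.range B, fderiv ℝ (fderiv ℝ fun θ => l θ (D b ω)) θ)
      (Metric.ball θ₀ (min η (δ / 2))) θ := fun θ hθ =>
    ((HasFDerivAt.fun_sum (u := Finset.range B) fun b _ =>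
      (hdiff2 θ (hKball (hsub hθ)) (D b ω)).hasFDerivAt).const_smul (B : ℝ)⁻¹).hasFDerivWithinAt
  -- One half of `ε` pays for the uniform law, the other for the continuity of the expected Hessian
  -- at `θ₀`.
  have hclose : ∀ θ ∈ Metric.ball θ₀ (min η (δ / 2)),
      ‖(B : ℝ)⁻¹ • ∑ b ∈ Finset.range B, fderiv ℝ (fderiv ℝ fun θ => l θ (D b ω)) θ - H θ₀‖ ≤
        ε := by
    intro θ hθ
    have h1 := hBu θ (hsub hθ)
    have h2 := hηH θ (hsub hθ) (lt_of_lt_of_le hθ (min_le_left _ _))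
    rw [← dist_eq_norm, dist_comm]
    calc _ ≤ dist (H θ₀) (H θ) + dist (H θ) _ := dist_triangle _ _ _
      _ ≤ ε / 2 + ε / 2 := add_le_add (by rw [dist_comm]; exact h2.le) h1.le
      _ = ε := add_halves ε
  -- Mean value inequality for the mean score `Ψ` minus the fixed linear map `H θ₀`. It replaces an
  -- intermediate point, which a vector-valued map need not have.
  have hmv := (convex_ball θ₀ (min η (δ / 2))).norm_image_sub_le_of_norm_hasFDerivWithin_le'
    hΨ' hclose (Metric.mem_ball_self (lt_min hη (half_pos hδ))) hB
  -- Consistency has brought the maximizer into the interior of `Θ`, so it is a critical point.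
  have hzero : Ψ (θhat B ω) = 0 := by
    have hin : θhat B ω ∈ Metric.ball θ₀ δ := hKball (hsub hB)
    have hloc : IsLocalMax (fun θ => ∑ b ∈ Finset.range B, l θ (D b ω)) (θhat B ω) := by
      filter_upwards [isOpen_interior.mem_nhds (hball hin).2] with y hy
      exact (hml B).2 y (interior_subset hy)
    have h0 := hloc.fderiv_eq_zero
    rw [fderiv_fun_sum fun b _ => hdiff _ hin (D b ω)] at h0
    simp only [hΨ, h0, smul_zero]
  rw [hzero, zero_sub, ← norm_neg, neg_sub, sub_neg_eq_add] at hmv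
  rw [add_comm]
  exact hmv

/-- Asymptotic normality of the maximum likelihood estimator, for a bounded log-likelihood that is
twice continuously differentiable near the true parameter and satisfies the information
equality. -/
theorem tendstoInDistribution_maximum_likelihood (hΘ : IsCompact Θ) (hθ₀ : θ₀ ∈ interior Θ)
    (hmeas : ∀ θ ∈ Θ, Measurable (l θ)) (hcont : ∀ a, ContinuousOn (fun θ => l θ a) Θ)
    (hbound : ∀ θ ∈ Θ, ∀ a, ‖l θ a‖ ≤ M)
    (hV : V ∈ 𝓝 θ₀) (hC2 : ∀ θ ∈ V, ∀ a, ContDiffAt ℝ 2 (fun θ => l θ a) θ)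
    (hd1 : ∀ θ ∈ V, ∀ a, ‖fderiv ℝ (fun θ => l θ a) θ‖ ≤ M)
    (hd2 : ∀ θ ∈ V, ∀ a, ‖fderiv ℝ (fderiv ℝ fun θ => l θ a) θ‖ ≤ M)
    (hmax : ∀ θ ∈ Θ, θ ≠ θ₀ → ∫ a, l θ a ∂ν < ∫ a, l θ₀ a ∂ν)
    (hscore : ∀ v, ∫ a, fderiv ℝ (fun θ => l θ a) θ₀ v ∂ν = 0)
    (hinfo : ∀ v w, ∫ a, (fderiv ℝ (fderiv ℝ fun θ => l θ a) θ₀ v w +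
      fderiv ℝ (fun θ => l θ a) θ₀ v * fderiv ℝ (fun θ => l θ a) θ₀ w) ∂ν = 0)
    {J : Matrix (Fin d) (Fin d) ℝ}
    (hJ : ∀ i j, J i j =
      ∫ a, gradient (fun θ => l θ a) θ₀ i * gradient (fun θ => l θ a) θ₀ j ∂ν)
    (hdet : IsUnit J.det) {D : ℕ → Ω → α} (hD : ∀ b, Measurable (D b)) (hindep : iIndepFun D μ)
    (hlaw : ∀ b, μ.map (D b) = ν) {θhat : ℕ → Ω → EuclideanSpace ℝ (Fin d)}
    (hθhat : ∀ B, AEMeasurable (θhat B) μ)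
    (hMLE : ∀ B, ∀ᵐ ω ∂μ, θhat B ω ∈ Θ ∧ ∀ θ ∈ Θ,
      ∑ b ∈ Finset.range B, l θ (D b ω) ≤ ∑ b ∈ Finset.range B, l (θhat B ω) (D b ω)) :
    (∀ i j, Integrable
      (fun a => gradient (fun θ => l θ a) θ₀ i * gradient (fun θ => l θ a) θ₀ j) ν) ∧
    J.PosDef ∧
    TendstoInDistribution (fun (B : ℕ) ω => √(B : ℝ) • (θhat B ω - θ₀)) atTop id
      (fun _ => μ) (multivariateGaussian 0 J⁻¹) := by
  have : IsProbabilityMeasure ν := by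
    rw [← hlaw 0]; exact Measure.isProbabilityMeasure_map (hD 0).aemeasurable
  have hθ₀V : θ₀ ∈ V := mem_of_mem_nhds hV
  have hM0 : 0 ≤ M := (norm_nonneg _).trans (hbound θ₀ (interior_subset hθ₀)
    (Classical.choice (nonempty_of_isProbabilityMeasure ν)))
  have hdiff : ∀ a, DifferentiableAt ℝ (fun θ => l θ a) θ₀ := fun a =>
    (hC2 θ₀ hθ₀V a).differentiableAt (by norm_num)
  set g : α → EuclideanSpace ℝ (Fin d) := fun a => gradient (fun θ => l θ a) θ₀ with hg
  have hgin : ∀ a v, ⟪g a, v⟫ = fderiv ℝ (fun θ => l θ a) θ₀ v := fun a v => by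
    simp [hg, gradient]
  have hgm : Measurable g := by
    refine (InnerProductSpace.toDual ℝ (EuclideanSpace ℝ (Fin d))).symm.continuous.measurable.comp
      (measurable_fderiv_of_eventually ?_ hdiff)
    filter_upwards [isOpen_interior.mem_nhds hθ₀] with y hy
    exact hmeas y (interior_subset hy)
  have hgM : ∀ a, ‖g a‖ ≤ M := fun a => by
    simpa [hg, gradient] using hd1 θ₀ hθ₀V a
  have hgmem : MemLp g 2 ν := MemLp.of_bound hgm.aestronglyMeasurable M (ae_of_all _ hgM)
  have hgij : ∀ i j, Integrable (fun a => g a i * g a j) ν := fun i j => by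
    refine Integrable.of_bound (C := M * M) ?_ (ae_of_all _ fun a => ?_)
    · exact Measurable.aestronglyMeasurable (by fun_prop)
    · rw [norm_mul]
      exact mul_le_mul ((PiLp.norm_apply_le (g a) i).trans (hgM a))
        ((PiLp.norm_apply_le (g a) j).trans (hgM a)) (norm_nonneg _) hM0
  have hpd : J.PosDef := posDef_of_integral_mul hgij hJ hdet
  refine ⟨hgij, hpd, ?_⟩
  have hcons := ae_tendsto_maximum_likelihood hΘ (interior_subset hθ₀) hmeas hcont hbound hmax hD
    hindep hlaw hMLE
  obtain ⟨hHi, hexp⟩ := ae_score_expansion hθ₀ hmeas hV hC2 hd2 hD hindep hlaw hMLE hcons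
  have hid : ∀ b, IdentDistrib (D b) (D 0) μ μ := fun b =>
    ⟨(hD b).aemeasurable, (hD 0).aemeasurable, by rw [hlaw, hlaw]⟩
  have hclt : TendstoInDistribution
      (fun (n : ℕ) ω => (√(n : ℝ))⁻¹ • ∑ b ∈ Finset.range n, g (D b ω)) atTop id
      (fun _ => μ) (multivariateGaussian 0 J) := by
    refine tendstoInDistribution_multivariateGaussian (X := fun b ω => g (D b ω))
      ((hlaw 0 ▸ hgmem).comp_measurePreserving ⟨hD 0, rfl⟩) (hindep.comp _ fun _ => hgm)
      (fun b => (hid b).comp hgm) hpd.posSemidef (fun t => ?_) (fun t => ?_)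
    · rw [← integral_map (hD 0).aemeasurable (f := fun a => ⟪g a, t⟫)
        (Measurable.aestronglyMeasurable (by fun_prop)), hlaw]
      simp_rw [hgin, hscore]
    · rw [← integral_map (hD 0).aemeasurable (f := fun a => ⟪g a, t⟫ ^ 2)
        (Measurable.aestronglyMeasurable (by fun_prop)), hlaw, ← integral_inner_mul_inner hgij hJ]
      simp_rw [pow_two]
  set T : EuclideanSpace ℝ (Fin d) →L[ℝ] EuclideanSpace ℝ (Fin d) :=
    Matrix.toEuclideanCLM (𝕜 := ℝ) J with hT
  set L : EuclideanSpace ℝ (Fin d) →L[ℝ] EuclideanSpace ℝ (Fin d) :=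
    Matrix.toEuclideanCLM (𝕜 := ℝ) J⁻¹ with hL
  have hLT : ∀ x, L (T x) = x := fun x => by
    rw [← mul_apply_eq_comp, hL, hT, ← map_mul, Matrix.nonsing_inv_mul _ hdet, map_one,
      one_apply_eq_self]
  -- The information equality identifies the expected Hessian with -J.
  have hHess : ∀ v w, (∫ a, fderiv ℝ (fderiv ℝ fun θ => l θ a) θ₀ ∂ν) v w = -⟪T v, w⟫ := by
    intro v w
    have hprod : Integrable (fun a => ⟪g a, v⟫ * ⟪g a, w⟫) ν := by
      have h : ∀ u, MemLp (fun a => ⟪g a, u⟫) 2 ν := fun u => hgmem.inner_const u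
      exact (h v).integrable_mul (h w)
    have h0 := hinfo v w
    simp_rw [← hgin] at h0
    rw [integral_add ((hHi.apply_continuousLinearMap v).apply_continuousLinearMap w) hprod] at h0
    rw [ContinuousLinearMap.integral_apply hHi,
      ContinuousLinearMap.integral_apply (hHi.apply_continuousLinearMap v),
      eq_neg_of_add_eq_zero_left h0]
    simp_rw [mul_comm ⟪_, v⟫]
    rw [integral_inner_mul_inner hgij hJ, real_inner_comm,
      EuclideanSpace.real_inner_eq_dotProduct]
    simp [hT]
  have hlin : ∀ᵐ ω ∂μ, ∀ ε > 0, ∀ᶠ B : ℕ in atTop,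
      ‖√(B : ℝ) • (θhat B ω - θ₀) - L ((√(B : ℝ))⁻¹ • ∑ b ∈ Finset.range B, g (D b ω))‖ ≤
        ε * ‖(√(B : ℝ))⁻¹ • ∑ b ∈ Finset.range B, g (D b ω)‖ := by
    filter_upwards [hexp] with ω hω ε hε
    -- The added 1 keeps `c` positive even in dimension 0, where `L` vanishes.
    set c := ‖L‖ + 1 with hc
    have hc0 : 0 < c := by positivity
    have hLc : ‖L‖ ≤ c := by linarith
    filter_upwards [hω (min (1 / (2 * c)) (ε / (2 * c ^ 2))) (by positivity),
      eventually_gt_atTop 0] with B hB hB0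
    set ε' := min (1 / (2 * c)) (ε / (2 * c ^ 2)) with hε'
    have hr : 0 < √(B : ℝ) := Real.sqrt_pos.2 (Nat.cast_pos.2 hB0)
    set s := (√(B : ℝ))⁻¹ • ∑ b ∈ Finset.range B, g (D b ω) with hs
    set h := √(B : ℝ) • (θhat B ω - θ₀) with hh
    -- Since √B · B⁻¹ = 1/√B, scaling the expansion by √B turns the mean score into the normalized
    -- sum `s` and the linear term into `-T h`.
    have hdual : InnerProductSpace.toDual ℝ (EuclideanSpace ℝ (Fin d)) (s - T h) =
        √(B : ℝ) • ((B : ℝ)⁻¹ • (∑ b ∈ Finset.range B, fderiv ℝ (fun θ => l θ (D b ω)) θ₀) +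
          (∫ a, fderiv ℝ (fderiv ℝ fun θ => l θ a) θ₀ ∂ν) (θhat B ω - θ₀)) := by
      ext w
      have hrB : √(B : ℝ) * (B : ℝ)⁻¹ = (√(B : ℝ))⁻¹ := by
        rw [← div_eq_mul_inv, Real.sqrt_div_self', one_div]
      simp only [InnerProductSpace.toDual_apply_apply, inner_sub_left, hs, hh, map_smul,
        real_inner_smul_left, sum_inner, hgin, smul_apply, add_apply, sum_apply, smul_eq_mul,
        hHess, mul_add, ← mul_assoc, hrB]
      ring
    have hst : ‖s - T h‖ ≤ ε' * ‖h‖ := by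
      rw [← (InnerProductSpace.toDual ℝ (EuclideanSpace ℝ (Fin d))).norm_map, hdual, norm_smul, hh,
        norm_smul, mul_left_comm]
      exact mul_le_mul_of_nonneg_left hB (norm_nonneg _)
    refine norm_sub_apply_le_of_approx hLT hLc hc0 (by positivity) ?_ ?_ hst
    · calc c * ε' ≤ c * (1 / (2 * c)) := mul_le_mul_of_nonneg_left (min_le_left _ _) hc0.le
        _ = 1 / 2 := by field_simp
    · calc 2 * c ^ 2 * ε' ≤ 2 * c ^ 2 * (ε / (2 * c ^ 2)) :=
            mul_le_mul_of_nonneg_left (min_le_right _ _) (by positivity)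
        _ = ε := by field_simp
  -- The covariance is J⁻¹ J (J⁻¹)ᵀ, which is J⁻¹ by symmetry.
  have hmap : (multivariateGaussian 0 J).map (L ∘ id) = multivariateGaussian 0 J⁻¹ := by
    rw [Function.comp_id, map_multivariateGaussian_zero hpd.posSemidef J⁻¹ L fun x => by simp [hL],
      Matrix.nonsing_inv_mul _ hdet, one_mul, Matrix.transpose_nonsing_inv,
      show J.transpose = J by simpa using hpd.isHermitian.eq]
  have hm : ∀ B : ℕ, AEMeasurable (fun ω => √(B : ℝ) • (θhat B ω - θ₀)) μ := fun B => by
    have h := (hθhat B).sub_const θ₀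
    exact h.const_smul (√(B : ℝ))
  exact (hclt.of_linear_approx hm L hlin).of_map_eq hmap

end MaximumLikelihood

/-! ### Second-order chain rule and Bartlett identities. -/

section SecondDerivative

variable {E F G : Type*} [NormedAddCommGroup E] [NormedSpace ℝ E] [NormedAddCommGroup F]
  [NormedSpace ℝ F] [NormedAddCommGroup G] [NormedSpace ℝ G]

lemma ContDiffAt.eventually_differentiableAt {f : E → F} {x : E} (hf : ContDiffAt ℝ 2 f x) :
    ∀ᶠ y in 𝓝 x, DifferentiableAt ℝ f y := by
  filter_upwards [hf.eventually (by simp)] with y hy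
  exact hy.differentiableAt (by norm_num)

lemma ContDiffAt.differentiableAt_fderiv {f : E → F} {x : E} (hf : ContDiffAt ℝ 2 f x) :
    DifferentiableAt ℝ (fderiv ℝ f) x :=
  (hf.fderiv_right (m := 1) (by norm_num)).differentiableAt one_ne_zero

lemma norm_fderiv_comp_le {φ : F → G} {ρ : E → F} {x : E} (hφ : DifferentiableAt ℝ φ (ρ x))
    (hρ : DifferentiableAt ℝ ρ x) :
    ‖fderiv ℝ (φ ∘ ρ) x‖ ≤ ‖fderiv ℝ φ (ρ x)‖ * ‖fderiv ℝ ρ x‖ := by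
  rw [fderiv_comp x hφ hρ]
  exact ContinuousLinearMap.opNorm_comp_le _ _

/-- The second-order chain rule: (φ ∘ ρ)'' = φ''(ρ', ρ') + φ'(ρ''). -/
lemma norm_fderiv_fderiv_comp_le {φ : F → G} {ρ : E → F} {x : E} (hφ : ContDiffAt ℝ 2 φ (ρ x))
    (hρ : ContDiffAt ℝ 2 ρ x) :
    ‖fderiv ℝ (fderiv ℝ (φ ∘ ρ)) x‖ ≤ ‖fderiv ℝ (fderiv ℝ φ) (ρ x)‖ * ‖fderiv ℝ ρ x‖ ^ 2 +
      ‖fderiv ℝ φ (ρ x)‖ * ‖fderiv ℝ (fderiv ℝ ρ) x‖ := by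
  have h1 : fderiv ℝ (φ ∘ ρ) =ᶠ[𝓝 x] fun y => (fderiv ℝ φ (ρ y)).comp (fderiv ℝ ρ y) := by
    filter_upwards [hρ.continuousAt.eventually hφ.eventually_differentiableAt,
      hρ.eventually_differentiableAt] with y hy1 hy2
    exact fderiv_comp y hy1 hy2
  have h2 := (hφ.differentiableAt_fderiv.hasFDerivAt.comp x
    (hρ.differentiableAt (by norm_num)).hasFDerivAt).clm_comp
      hρ.differentiableAt_fderiv.hasFDerivAt
  rw [h1.fderiv_eq]
  have h3 : fderiv ℝ (fun y => (fderiv ℝ φ (ρ y)).comp (fderiv ℝ ρ y)) x = _ := h2.fderiv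
  rw [h3]
  refine ContinuousLinearMap.opNorm_le_bound _ (by positivity) fun v => ?_
  have e1 : ‖(fderiv ℝ φ (ρ x)).comp (fderiv ℝ (fderiv ℝ ρ) x v)‖ ≤
      ‖fderiv ℝ φ (ρ x)‖ * (‖fderiv ℝ (fderiv ℝ ρ) x‖ * ‖v‖) :=
    (ContinuousLinearMap.opNorm_comp_le _ _).trans
      (mul_le_mul_of_nonneg_left (ContinuousLinearMap.le_opNorm _ _) (norm_nonneg _))
  have e2 : ‖(fderiv ℝ (fderiv ℝ φ) (ρ x) (fderiv ℝ ρ x v)).comp (fderiv ℝ ρ x)‖ ≤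
      ‖fderiv ℝ (fderiv ℝ φ) (ρ x)‖ * (‖fderiv ℝ ρ x‖ * ‖v‖) * ‖fderiv ℝ ρ x‖ :=
    (ContinuousLinearMap.opNorm_comp_le _ _).trans
      (mul_le_mul_of_nonneg_right ((ContinuousLinearMap.le_opNorm _ _).trans
        (mul_le_mul_of_nonneg_left (ContinuousLinearMap.le_opNorm _ _) (norm_nonneg _)))
        (norm_nonneg _))
  refine (norm_add_le ((fderiv ℝ φ (ρ x)).comp (fderiv ℝ (fderiv ℝ ρ) x v))
    ((fderiv ℝ (fderiv ℝ φ) (ρ x) (fderiv ℝ ρ x v)).comp (fderiv ℝ ρ x))).trans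
    ((add_le_add e1 e2).trans (le_of_eq (by ring)))

lemma fderiv_fderiv_clm_comp (P : F →L[ℝ] G) {ρ : E → F} {x : E} (hρ : ContDiffAt ℝ 2 ρ x)
    (v w : E) : fderiv ℝ (fderiv ℝ fun y => P (ρ y)) x v w = P (fderiv ℝ (fderiv ℝ ρ) x v w) := by
  have h1 : fderiv ℝ (fun y => P (ρ y)) =ᶠ[𝓝 x] fun y => P.comp (fderiv ℝ ρ y) := by
    filter_upwards [hρ.eventually_differentiableAt] with y hy
    exact (P.hasFDerivAt.comp y hy.hasFDerivAt).fderiv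
  have h2 := (hasFDerivAt_const P x).clm_comp hρ.differentiableAt_fderiv.hasFDerivAt
  rw [h1.fderiv_eq, h2.fderiv]
  simp

variable {ι κ : Type*} [Fintype ι] [Fintype κ]

/-- Bounds for the derivatives of a map into a finite product from bounds for its components. -/
lemma norm_fderiv_pi_pi_le {ρ : E → ι → κ → ℝ} {x : E} {M : ℝ} (hM : 0 ≤ M)
    (hρ : ∀ i j, ContDiffAt ℝ 2 (fun y => ρ y i j) x)
    (h1 : ∀ i j, ‖fderiv ℝ (fun y => ρ y i j) x‖ ≤ M)
    (h2 : ∀ i j, ‖fderiv ℝ (fderiv ℝ fun y => ρ y i j) x‖ ≤ M) :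
    ContDiffAt ℝ 2 ρ x ∧ ‖fderiv ℝ ρ x‖ ≤ M ∧ ‖fderiv ℝ (fderiv ℝ ρ) x‖ ≤ M := by
  have hC : ContDiffAt ℝ 2 ρ x := contDiffAt_pi.2 fun i => contDiffAt_pi.2 fun j => hρ i j
  let P : ι → κ → (ι → κ → ℝ) →L[ℝ] ℝ := fun i j =>
    (ContinuousLinearMap.proj (R := ℝ) (φ := fun _ : κ => ℝ) j).comp
      (ContinuousLinearMap.proj (R := ℝ) (φ := fun _ : ι => κ → ℝ) i)
  refine ⟨hC, ?_, ?_⟩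
  · refine ContinuousLinearMap.opNorm_le_bound _ hM fun v => ?_
    refine (pi_norm_le_iff_of_nonneg (by positivity)).2 fun i =>
      (pi_norm_le_iff_of_nonneg (by positivity)).2 fun j => ?_
    have h : fderiv ℝ (fun y => ρ y i j) x v = fderiv ℝ ρ x v i j := by
      have := ((P i j).hasFDerivAt.comp x (hC.differentiableAt (by norm_num)).hasFDerivAt).fderiv
      have h' : fderiv ℝ (fun y => ρ y i j) x = (P i j).comp (fderiv ℝ ρ x) := this
      rw [h']
      rfl
    rw [← h]
    exact (ContinuousLinearMap.le_opNorm _ _).trans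
      (mul_le_mul_of_nonneg_right (h1 i j) (norm_nonneg _))
  · refine ContinuousLinearMap.opNorm_le_bound₂ _ hM fun v w => ?_
    refine (pi_norm_le_iff_of_nonneg (by positivity)).2 fun i =>
      (pi_norm_le_iff_of_nonneg (by positivity)).2 fun j => ?_
    have h : fderiv ℝ (fderiv ℝ fun y => ρ y i j) x v w = fderiv ℝ (fderiv ℝ ρ) x v w i j :=
      fderiv_fderiv_clm_comp (P i j) hC v w
    rw [← h]
    exact (ContinuousLinearMap.le_opNorm₂ _ _ _).trans
      (mul_le_mul_of_nonneg_right (mul_le_mul_of_nonneg_right (h2 i j) (norm_nonneg _))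
        (norm_nonneg _))

/-- The Bartlett identities for a finite family of log-probabilities. -/
lemma bartlett_identities {f : ι → E → ℝ} {x : E} (hf : ∀ i, ContDiffAt ℝ 2 (f i) x)
    (hsum : ∀ᶠ y in 𝓝 x, ∑ i, Real.exp (f i y) = 1) :
    (∀ v, ∑ i, Real.exp (f i x) * fderiv ℝ (f i) x v = 0) ∧
    ∀ v w, ∑ i, Real.exp (f i x) *
      (fderiv ℝ (fderiv ℝ (f i)) x v w + fderiv ℝ (f i) x v * fderiv ℝ (f i) x w) = 0 := by
  -- The first derivative of the identity Σ exp fᵢ = 1 vanishes on a whole neighbourhood, not only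
  -- at `x`, so it may be differentiated once more.
  have hG : ∀ᶠ y in 𝓝 x, ∑ i, Real.exp (f i y) • fderiv ℝ (f i) y = 0 := by
    have hev : (fun y => ∑ i, Real.exp (f i y)) =ᶠ[𝓝 x] fun _ => 1 := hsum
    filter_upwards [hev.eventuallyEq_nhds,
      eventually_all.2 fun i => (hf i).eventually_differentiableAt] with y hy1 hy2
    have h := HasFDerivAt.fun_sum (u := Finset.univ) fun i _ => (hy2 i).hasFDerivAt.exp
    rw [← h.fderiv, hy1.fderiv_eq, fderiv_const_apply]
  refine ⟨fun v => ?_, fun v w => ?_⟩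
  · simpa using DFunLike.congr_fun hG.self_of_nhds v
  · have h := HasFDerivAt.fun_sum (u := Finset.univ) fun i _ =>
      ((hf i).differentiableAt (by norm_num)).hasFDerivAt.exp.smul
        (hf i).differentiableAt_fderiv.hasFDerivAt
    have h0 : HasFDerivAt (fun y => ∑ i, Real.exp (f i y) • fderiv ℝ (f i) y)
        (0 : E →L[ℝ] E →L[ℝ] ℝ) x := (hasFDerivAt_const _ x).congr_of_eventuallyEq hG
    have h1 := DFunLike.congr_fun (DFunLike.congr_fun (h.unique h0) v) w
    simp only [sum_apply, add_apply, smul_apply, ContinuousLinearMap.smulRight_apply, smul_eq_mul,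
      zero_apply] at h1
    rw [← h1]
    exact Finset.sum_congr rfl fun i _ => by ring

end SecondDerivative

namespace PeerEffects

/-! ### Uniform bounds for the log-likelihood as a function of the rates. -/

section LogTransition

lemma transition_pos {n : ℕ} {W : Fin n → Fin n → Bool} {r : Fin n → Finset (Fin n) → ℝ} {S : ℝ}
    (hS : 0 < S) (hr : ∀ i C, 0 < r i C) (D : Finset (Fin n)) : 0 < transition W S ∅ D r :=
  (adoptersProb_eq_ofReal_transition hr D n ∅ S hS.le (Nat.le_add_right _ _)).2.2
    (Finset.empty_subset D) hS

lemma contDiffAt_log_transition {n : ℕ} {W : Fin n → Fin n → Bool}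
    {r : Fin n → Finset (Fin n) → ℝ} {S : ℝ} (hS : 0 < S) (hr : ∀ i C, 0 < r i C)
    (D : Finset (Fin n)) : ContDiffAt ℝ 2 (fun r => Real.log (transition W S ∅ D r)) r :=
  (contDiff_transition S).contDiffAt.log (transition_pos hS hr D).ne'

/-- For fixed size, network and adopter set, a C² function is bounded with its derivatives on the
compact box of rates. There are finitely many such triples, and covariates do not occur, so the
bounds add up to one constant. -/
lemma exists_bound_log_transition (Nbar : ℕ) {S lo : ℝ} (hS : 0 < S) (hlo : 0 < lo) (hi : ℝ) :
    ∃ M, 0 ≤ M ∧ ∀ (n : Fin Nbar) (W : Fin n → Fin n → Bool) (D : Finset (Fin n))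
      (r : Fin n → Finset (Fin n) → ℝ), (∀ i C, r i C ∈ Set.Icc lo hi) →
      ‖Real.log (transition W S ∅ D r)‖ ≤ M ∧
      ‖fderiv ℝ (fun r => Real.log (transition W S ∅ D r)) r‖ ≤ M ∧
      ‖fderiv ℝ (fderiv ℝ fun r => Real.log (transition W S ∅ D r)) r‖ ≤ M := by
  have key : ∀ p : Σ n : Fin Nbar, (Fin n → Fin n → Bool) × Finset (Fin n), ∃ M, 0 ≤ M ∧
      ∀ r : Fin p.1 → Finset (Fin p.1) → ℝ, (∀ i C, r i C ∈ Set.Icc lo hi) →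
      ‖Real.log (transition p.2.1 S ∅ p.2.2 r)‖ ≤ M ∧
      ‖fderiv ℝ (fun r => Real.log (transition p.2.1 S ∅ p.2.2 r)) r‖ ≤ M ∧
      ‖fderiv ℝ (fderiv ℝ fun r => Real.log (transition p.2.1 S ∅ p.2.2 r)) r‖ ≤ M := by
    rintro ⟨n, W, D⟩
    set K : Set (Fin n → Finset (Fin n) → ℝ) :=
      Set.univ.pi fun _ => Set.univ.pi fun _ => Set.Icc lo hi with hK
    have hKc : IsCompact K := isCompact_univ_pi fun _ => isCompact_univ_pi fun _ => isCompact_Icc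
    have hC : ∀ r ∈ K, ContDiffAt ℝ 2 (fun r => Real.log (transition W S ∅ D r)) r :=
      fun r hr => contDiffAt_log_transition hS
        (fun i C => hlo.trans_le (hr i (Set.mem_univ i) C (Set.mem_univ C)).1) D
    obtain ⟨M0, h0⟩ := hKc.exists_bound_of_continuousOn
      (fun r hr => (hC r hr).continuousAt.continuousWithinAt)
    obtain ⟨M1, h1⟩ := hKc.exists_bound_of_continuousOn
      (fun r hr => ((hC r hr).continuousAt_fderiv (by norm_num)).continuousWithinAt)
    obtain ⟨M2, h2⟩ := hKc.exists_bound_of_continuousOn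
      (fun r hr => (((hC r hr).fderiv_right (m := 1) (by norm_num)).continuousAt_fderiv
        one_ne_zero).continuousWithinAt)
    refine ⟨max 0 (max M0 (max M1 M2)), le_max_left _ _, fun r hr => ?_⟩
    have hrK : r ∈ K := fun i _ C _ => hr i C
    exact ⟨(h0 r hrK).trans (by simp), (h1 r hrK).trans (by simp), (h2 r hrK).trans (by simp)⟩
  choose M hM hMb using key
  refine ⟨∑ p, M p, Finset.sum_nonneg fun p _ => hM p, fun n W D r hr => ?_⟩
  have hle : M ⟨n, W, D⟩ ≤ ∑ p, M p :=
    Finset.single_le_sum (f := M) (fun p _ => hM p) (Finset.mem_univ _)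
  obtain ⟨h0, h1, h2⟩ := hMb ⟨n, W, D⟩ r hr
  exact ⟨h0.trans hle, h1.trans hle, h2.trans hle⟩

end LogTransition

/-! ### The likelihood as a probability on outcomes. -/

section Likelihood

variable {P : Type*} {Nbar : ℕ} {𝒳 : Type*} {S : ℝ} {rate : RateFamily P Nbar 𝒳} {θ : P}

lemma likelihood_eq (hS : 0 < S) (hr : ∀ z i C, 0 < rate θ z i C) (z : Block Nbar 𝒳)
    (y : Fin z.1 → Bool) : likelihood S rate θ z y =
      ENNReal.ofReal (transition z.2.1 S ∅ (Finset.univ.filter fun i => y i = true) (rate θ z)) :=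
  (adoptersProb_eq_ofReal_transition (hr z) _ _ _ _ hS.le (Nat.le_add_right _ _)).1

lemma logLik_eq (hS : 0 < S) (hr : ∀ z i C, 0 < rate θ z i C) (o : BlockObs Nbar 𝒳) :
    logLik S rate θ o = Real.log (transition o.2.1.1 S ∅
      (Finset.univ.filter fun i => o.2.2 i = true) (rate θ ⟨o.1, o.2.1⟩)) := by
  rw [logLik, likelihood_eq hS hr, ENNReal.toReal_ofReal (transition_pos hS (hr _) _).le]

lemma likelihood_eq_exp (hS : 0 < S) (hr : ∀ z i C, 0 < rate θ z i C) (z : Block Nbar 𝒳)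
    (y : Fin z.1 → Bool) :
    likelihood S rate θ z y = ENNReal.ofReal (Real.exp (logLik S rate θ ⟨z.1, (z.2, y)⟩)) := by
  rw [likelihood_eq hS hr, logLik_eq hS hr, Real.exp_log (transition_pos hS (hr _) _)]

/-- Outcome vectors correspond bijectively to adopter sets, so this is conservation of mass for the
jump process. -/
lemma sum_exp_logLik (hS : 0 < S) (hr : ∀ z i C, 0 < rate θ z i C) (z : Block Nbar 𝒳) :
    ∑ y : Fin z.1 → Bool, Real.exp (logLik S rate θ ⟨z.1, (z.2, y)⟩) = 1 := by
  have hbij : Function.Bijective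
      (fun y : Fin z.1 → Bool => (Finset.univ.filter fun i => y i = true)) := by
    refine ⟨fun y y' h => ?_, fun D => ⟨fun i => decide (i ∈ D), by ext; simp⟩⟩
    ext i
    have := Finset.ext_iff.1 h i
    simp only [Finset.mem_filter, Finset.mem_univ, true_and] at this
    exact Bool.eq_iff_iff.2 this
  rw [← sum_transition (W := z.2.1) (A := ∅) (r := rate θ z) S, ← hbij.sum_comp]
  refine Finset.sum_congr rfl fun y _ => ?_
  rw [logLik_eq hS hr, Real.exp_log (transition_pos hS (hr _) _)]

lemma sum_likelihood (hS : 0 < S) (hr : ∀ z i C, 0 < rate θ z i C) (z : Block Nbar 𝒳) :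
    ∑ y : Fin z.1 → Bool, likelihood S rate θ z y = 1 := by
  simp_rw [likelihood_eq_exp hS hr]
  rw [← ENNReal.ofReal_sum_of_nonneg fun _ _ => (Real.exp_pos _).le, sum_exp_logLik hS hr,
    ENNReal.ofReal_one]

end Likelihood

/-! ### The law of an observation and the Kullback–Leibler inequality. -/

section Measurability

lemma measurable_sigma {ι β : Type*} {α : ι → Type*} [∀ i, MeasurableSpace (α i)]
    [MeasurableSpace β] {f : (Σ i, α i) → β} (hf : ∀ i, Measurable fun a => f ⟨i, a⟩) :
    Measurable f := fun _ hs =>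
  MeasurableSpace.measurableSet_iInf.2 fun i => hf i hs

lemma measurable_sigma_mk {ι : Type*} {α : ι → Type*} [∀ i, MeasurableSpace (α i)] (i : ι) :
    Measurable (Sigma.mk i : α i → Σ i, α i) := fun _ hs =>
  MeasurableSpace.measurableSet_iInf.1 hs i

variable {P : Type*} {Nbar : ℕ} {𝒳 : Type*} [MeasurableSpace 𝒳] {S : ℝ}
  {rate : RateFamily P Nbar 𝒳} {θ θ' : P} {𝒟 : Measure (Block Nbar 𝒳)}

lemma measurable_transition {n : ℕ} (W : Fin n → Fin n → Bool) (S : ℝ) (A D : Finset (Fin n)) :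
    Measurable (transition W S A D) :=
  (contDiff_transition (N := 0) S).continuous.measurable

lemma measurable_logLik (hS : 0 < S) (hr : ∀ z i C, 0 < rate θ z i C)
    (hm : ∀ (n : Fin Nbar) (W : Fin n → Fin n → Bool) (i : Fin n) (C : Finset (Fin n)),
      Measurable fun x : Fin n → 𝒳 => rate θ ⟨n, (W, x)⟩ i C) :
    Measurable (logLik S rate θ) := by
  have key : ∀ (n : Fin Nbar) (W : Fin n → Fin n → Bool) (y : Fin n → Bool),
      Measurable fun x : Fin n → 𝒳 => logLik S rate θ ⟨n, ((W, x), y)⟩ := by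
    intro n W y
    let ρ : (Fin n → 𝒳) → Fin n → Finset (Fin n) → ℝ := fun x => rate θ ⟨n, (W, x)⟩
    have hx : Measurable ρ :=
      measurable_pi_iff.2 fun i => measurable_pi_iff.2 fun C => hm n W i C
    have h : (fun x : Fin n → 𝒳 => logLik S rate θ ⟨n, ((W, x), y)⟩) = fun x => Real.log
        (transition W S ∅ (Finset.univ.filter fun i => y i = true) (ρ x)) :=
      funext fun x => logLik_eq hS hr _
    rw [h]
    exact Real.measurable_log.comp ((measurable_transition W S _ _).comp hx)
  have key' : ∀ n : Fin Nbar, Measurable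
      fun p : ((Fin n → Fin n → Bool) × (Fin n → 𝒳)) × (Fin n → Bool) =>
        logLik S rate θ ⟨n, p⟩ := by
    intro n
    refine measurable_from_prod_countable_left fun y => ?_
    exact measurable_from_prod_countable_right fun W => key n W y
  exact fun s hs => MeasurableSpace.measurableSet_iInf.2 fun n => key' n hs

lemma measurable_outcomeLaw (hS : 0 < S) (hr : ∀ z i C, 0 < rate θ z i C)
    (hl : Measurable (logLik S rate θ)) : Measurable (outcomeLaw S rate θ) := by
  refine Measure.measurable_of_measurable_coe _ fun s hs => measurable_sigma fun n => ?_
  simp only [outcomeLaw, Measure.coe_finsetSum, Finset.sum_apply, Measure.smul_apply, smul_eq_mul,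
    likelihood_eq_exp hS hr]
  refine Finset.measurable_fun_sum (M := ℝ≥0∞) (Finset.univ : Finset (Fin n → Bool))
    (f := fun y w => ENNReal.ofReal (Real.exp (logLik S rate θ ⟨n, (w, y)⟩)) *
      Measure.dirac (⟨n, (w, y)⟩ : BlockObs Nbar 𝒳) s) fun y _ => ?_
  have hmk : Measurable fun w : (Fin n → Fin n → Bool) × (Fin n → 𝒳) =>
      (⟨n, (w, y)⟩ : BlockObs Nbar 𝒳) :=
    (measurable_sigma_mk n).comp (measurable_id.prodMk measurable_const)
  exact (ENNReal.measurable_ofReal.comp (Real.measurable_exp.comp (hl.comp hmk))).mul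
    ((Measure.measurable_coe hs).comp (Measure.measurable_dirac.comp hmk))

lemma isProbabilityMeasure_outcomeLaw (hS : 0 < S) (hr : ∀ z i C, 0 < rate θ z i C)
    (z : Block Nbar 𝒳) : IsProbabilityMeasure (outcomeLaw S rate θ z) := by
  constructor
  simp [outcomeLaw, Measure.coe_finsetSum, sum_likelihood hS hr]

lemma integral_outcomeLaw (hS : 0 < S) (hr : ∀ z i C, 0 < rate θ z i C)
    {h : BlockObs Nbar 𝒳 → ℝ} (hm : Measurable h) (z : Block Nbar 𝒳) :
    ∫ o, h o ∂(outcomeLaw S rate θ z) = ∑ y : Fin z.1 → Bool,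
      Real.exp (logLik S rate θ ⟨z.1, (z.2, y)⟩) * h ⟨z.1, (z.2, y)⟩ := by
  rw [outcomeLaw, integral_finsetSum_measure]
  · refine Finset.sum_congr rfl fun y _ => ?_
    rw [integral_smul_measure, integral_dirac' _ _ hm.stronglyMeasurable, smul_eq_mul,
      likelihood_eq_exp hS hr, ENNReal.toReal_ofReal (Real.exp_pos _).le]
  · intro y _
    refine Integrable.smul_measure ?_ (by rw [likelihood_eq_exp hS hr]; exact ENNReal.ofReal_ne_top)
    exact (integrable_dirac' hm.stronglyMeasurable (by simp))

/-- Conditioning on the characteristics leaves a finite sum over outcomes, so that identities valid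
block by block pass to expectations. -/
lemma integral_modelLaw [IsProbabilityMeasure 𝒟] (hS : 0 < S) (hr : ∀ z i C, 0 < rate θ z i C)
    (hl : Measurable (logLik S rate θ)) {h : BlockObs Nbar 𝒳 → ℝ} (hm : Measurable h)
    (hi : Integrable h (modelLaw S rate 𝒟 θ)) :
    ∫ o, h o ∂(modelLaw S rate 𝒟 θ) = ∫ z : Block Nbar 𝒳, ∑ y : Fin z.1 → Bool,
      Real.exp (logLik S rate θ ⟨z.1, (z.2, y)⟩) * h ⟨z.1, (z.2, y)⟩ ∂𝒟 := by
  let κ : Kernel (Block Nbar 𝒳) (BlockObs Nbar 𝒳) :=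
    ⟨outcomeLaw S rate θ, measurable_outcomeLaw hS hr hl⟩
  have : IsMarkovKernel κ := ⟨isProbabilityMeasure_outcomeLaw hS hr⟩
  have h0 : modelLaw S rate 𝒟 θ = 𝒟.bind κ := rfl
  rw [h0, Measure.comp_eq_comp_const_apply (κ := κ) (μ := 𝒟)] at hi ⊢
  rw [Kernel.integral_comp hi, Kernel.const_apply]
  exact integral_congr_ae (ae_of_all _ fun z => integral_outcomeLaw hS hr hm z)

lemma isProbabilityMeasure_modelLaw [IsProbabilityMeasure 𝒟] (hS : 0 < S)
    (hr : ∀ z i C, 0 < rate θ z i C) (hl : Measurable (logLik S rate θ)) :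
    IsProbabilityMeasure (modelLaw S rate 𝒟 θ) := by
  constructor
  have := isProbabilityMeasure_outcomeLaw (rate := rate) (θ := θ) hS hr
  rw [modelLaw, Measure.bind_apply MeasurableSet.univ (measurable_outcomeLaw hS hr hl).aemeasurable]
  simp

/-- The expected log-likelihood is uniquely maximized by the true law. -/
lemma integral_logLik_lt [IsProbabilityMeasure 𝒟] (hS : 0 < S) (hr : ∀ z i C, 0 < rate θ z i C)
    (hr' : ∀ z i C, 0 < rate θ' z i C) (hl : Measurable (logLik S rate θ))
    (hl' : Measurable (logLik S rate θ')) {M : ℝ} (hb : ∀ o, ‖logLik S rate θ o‖ ≤ M)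
    (hb' : ∀ o, ‖logLik S rate θ' o‖ ≤ M) (hne : modelLaw S rate 𝒟 θ' ≠ modelLaw S rate 𝒟 θ) :
    ∫ o, logLik S rate θ' o ∂(modelLaw S rate 𝒟 θ) <
      ∫ o, logLik S rate θ o ∂(modelLaw S rate 𝒟 θ) := by
  have := isProbabilityMeasure_modelLaw (𝒟 := 𝒟) hS hr hl
  by_contra! hle
  apply hne
  have hi : Integrable (logLik S rate θ) (modelLaw S rate 𝒟 θ) :=
    Integrable.of_bound hl.aestronglyMeasurable M (ae_of_all _ hb)
  have hi' : Integrable (logLik S rate θ') (modelLaw S rate 𝒟 θ) :=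
    Integrable.of_bound hl'.aestronglyMeasurable M (ae_of_all _ hb')
  -- `w` is the log-likelihood ratio, with E exp w = 1. Since exp w - 1 - w ≥ 0, with equality only
  -- at w = 0, the assumption E w ≥ 0 forces w = 0 almost surely.
  set w : BlockObs Nbar 𝒳 → ℝ := fun o => logLik S rate θ' o - logLik S rate θ o with hw
  have hwm : Measurable w := hl'.sub hl
  have hem : Measurable fun o => Real.exp (w o) := Real.measurable_exp.comp hwm
  have hei : Integrable (fun o => Real.exp (w o)) (modelLaw S rate 𝒟 θ) := by
    refine Integrable.of_bound hem.aestronglyMeasurable (Real.exp (2 * M)) (ae_of_all _ fun o => ?_)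
    rw [Real.norm_eq_abs, Real.abs_exp, Real.exp_le_exp]
    have h1 := abs_le.1 (hb o)
    have h2 := abs_le.1 (hb' o)
    simp only [hw]
    linarith [h1.1, h2.2]
  have he1 : ∫ o, Real.exp (w o) ∂(modelLaw S rate 𝒟 θ) = 1 := by
    rw [integral_modelLaw hS hr hl hem hei]
    simp_rw [← Real.exp_add, hw, add_sub_cancel, sum_exp_logLik hS hr']
    simp
  have hu0 : ∀ o, 0 ≤ Real.exp (w o) - 1 - w o := fun o => by
    linarith [Real.add_one_le_exp (w o)]
  have hwi : Integrable w (modelLaw S rate 𝒟 θ) := hi'.sub hi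
  have hui : Integrable (fun o => Real.exp (w o) - 1 - w o) (modelLaw S rate 𝒟 θ) :=
    (hei.sub (integrable_const 1)).sub hwi
  have huint : ∫ o, (Real.exp (w o) - 1 - w o) ∂(modelLaw S rate 𝒟 θ) ≤ 0 := by
    have hei1 : Integrable (fun o => Real.exp (w o) - 1) (modelLaw S rate 𝒟 θ) :=
      hei.sub (integrable_const 1)
    rw [integral_sub hei1 hwi, integral_sub hei (integrable_const 1), he1, hw,
      integral_sub hi' hi]
    simp
    linarith
  have hae := (integral_eq_zero_iff_of_nonneg hu0 hui).1
    (le_antisymm huint (integral_nonneg hu0))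
  have hw0 : ∀ᵐ o ∂(modelLaw S rate 𝒟 θ), w o = 0 := by
    filter_upwards [hae] with o ho
    by_contra hne0
    have := Real.add_one_lt_exp hne0
    simp only [Pi.zero_apply] at ho
    linarith
  -- For almost every block every outcome has positive probability, so w = 0 at each outcome and the
  -- two conditional laws coincide.
  have hz := Measure.ae_ae_of_ae_bind (measurable_outcomeLaw hS hr hl).aemeasurable hw0
  refine Measure.bind_congr_right ?_
  filter_upwards [hz] with z hz
  rw [outcomeLaw, ae_finsetSum_measure_iff] at hz
  refine Finset.sum_congr rfl fun y _ => ?_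
  congr 1
  have hy := hz y (Finset.mem_univ y)
  rw [Measure.ae_ennreal_smul_measure_iff
    (by rw [likelihood_eq_exp hS hr]; simp [Real.exp_pos])] at hy
  have hy0 : w ⟨z.1, (z.2, y)⟩ = 0 :=
    (ae_dirac_iff (p := fun o => w o = 0) (hwm (measurableSet_singleton 0))).1 hy
  rw [likelihood_eq_exp hS hr, likelihood_eq_exp hS hr', sub_eq_zero.1 hy0]

end Measurability

end PeerEffects

/-! ### The delta method. -/

section DeltaMethod

/-- The delta method along a strongly consistent sequence of estimators. -/
theorem MeasureTheory.TendstoInDistribution.delta_method {Ω Ω' E F : Type*} [MeasurableSpace Ω]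
    [MeasurableSpace Ω'] {μ : Measure Ω} [IsProbabilityMeasure μ] {μ' : Measure Ω'}
    [IsProbabilityMeasure μ'] [NormedAddCommGroup E] [NormedSpace ℝ E] [SecondCountableTopology E]
    [MeasurableSpace E] [BorelSpace E] [NormedAddCommGroup F] [NormedSpace ℝ F]
    [SecondCountableTopology F] [MeasurableSpace F] [BorelSpace F] {T : ℕ → Ω → E} {Z : Ω' → E}
    {θ₀ : E}
    (hT : TendstoInDistribution (fun (n : ℕ) ω => √(n : ℝ) • (T n ω - θ₀)) atTop Z (fun _ => μ) μ')
    (hcons : ∀ᵐ ω ∂μ, Tendsto (fun n => T n ω) atTop (𝓝 θ₀)) {f : E → F} {L : E →L[ℝ] F}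
    (hf : HasFDerivAt f L θ₀) (hfT : ∀ n, AEMeasurable (fun ω => f (T n ω)) μ) :
    TendstoInDistribution (fun (n : ℕ) ω => √(n : ℝ) • (f (T n ω) - f θ₀)) atTop (L ∘ Z)
      (fun _ => μ) μ' := by
  have hm : ∀ n : ℕ, AEMeasurable (fun ω => √(n : ℝ) • (f (T n ω) - f θ₀)) μ := fun n => by
    have h := (hfT n).sub_const (f θ₀)
    exact h.const_smul (√(n : ℝ))
  refine hT.of_linear_approx hm L ?_
  filter_upwards [hcons] with ω hω ε hε
  filter_upwards [hω.eventually (hf.isLittleO.def hε)] with n hn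
  rw [map_smul, ← smul_sub, norm_smul, norm_smul, mul_left_comm]
  exact mul_le_mul_of_nonneg_left hn (norm_nonneg _)

/-- The rates are controlled only on `Θ`, where the estimator lies almost surely; extension by a
constant off the set supplies a measurable version. -/
lemma AEMeasurable.continuousOn_comp {Ω E F : Type*} [MeasurableSpace Ω] {μ : Measure Ω}
    [TopologicalSpace E] [MeasurableSpace E] [BorelSpace E] [TopologicalSpace F]
    [MeasurableSpace F] [BorelSpace F] [Zero F] {s : Set E} (hs : MeasurableSet s) {f : E → F}
    (hf : ContinuousOn f s) {T : Ω → E} (hT : AEMeasurable T μ) (hTs : ∀ᵐ ω ∂μ, T ω ∈ s) :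
    AEMeasurable (fun ω => f (T ω)) μ := by
  classical
  have hm : Measurable (s.piecewise f fun _ => 0) :=
    hf.measurable_piecewise continuousOn_const hs
  refine (hm.comp_aemeasurable hT).congr ?_
  filter_upwards [hTs] with ω hω
  simp [Set.piecewise, hω]

end DeltaMethod

/-! ### From derivatives of the rates to derivatives of the log-likelihood. -/

namespace PeerEffects

variable {Nbar d : ℕ} {𝒳 : Type*}

/-- Chain rule for θ ↦ rates of the block ↦ log-transition. This factorization is available only
where the rates are positive, hence the neighbourhood `U`; `M` bounds the derivatives of the inner
map and `K` those of the outer one. -/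
lemma logLik_derivative_bounds {E : Type*} [NormedAddCommGroup E] [NormedSpace ℝ E] {S lo hi : ℝ}
    (hS : 0 < S) (hlo : 0 < lo) {rate : RateFamily E Nbar 𝒳} {θ : E} {U : Set E} (hU : U ∈ 𝓝 θ)
    (hb : ∀ θ' ∈ U, ∀ z i C, rate θ' z i C ∈ Set.Icc lo hi) {M : ℝ} (hM : 0 ≤ M)
    (hC : ∀ z i C, ContDiffAt ℝ 2 (fun θ' => rate θ' z i C) θ)
    (h1 : ∀ z i C, ‖fderiv ℝ (fun θ' => rate θ' z i C) θ‖ ≤ M)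
    (h2 : ∀ z i C, ‖fderiv ℝ (fderiv ℝ fun θ' => rate θ' z i C) θ‖ ≤ M) {K : ℝ}
    (hK : ∀ (n : Fin Nbar) (W : Fin n → Fin n → Bool) (D : Finset (Fin n))
      (r : Fin n → Finset (Fin n) → ℝ), (∀ i C, r i C ∈ Set.Icc lo hi) →
      ‖fderiv ℝ (fun r => Real.log (transition W S ∅ D r)) r‖ ≤ K ∧
      ‖fderiv ℝ (fderiv ℝ fun r => Real.log (transition W S ∅ D r)) r‖ ≤ K)
    (o : BlockObs Nbar 𝒳) :
    ContDiffAt ℝ 2 (fun θ' => logLik S rate θ' o) θ ∧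
    ‖fderiv ℝ (fun θ' => logLik S rate θ' o) θ‖ ≤ K * M ∧
    ‖fderiv ℝ (fderiv ℝ fun θ' => logLik S rate θ' o) θ‖ ≤ K * M ^ 2 + K * M := by
  obtain ⟨n, ⟨W, x⟩, y⟩ := o
  set D := Finset.univ.filter fun i => y i = true with hD
  let ρ : E → Fin n → Finset (Fin n) → ℝ := fun θ' => rate θ' ⟨n, (W, x)⟩
  let φ : (Fin n → Finset (Fin n) → ℝ) → ℝ := fun r => Real.log (transition W S ∅ D r)
  have hθ := hb θ (mem_of_mem_nhds hU)
  obtain ⟨hρC, hρ1, hρ2⟩ := norm_fderiv_pi_pi_le (ρ := ρ) hM (fun i C => hC ⟨n, (W, x)⟩ i C)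
    (fun i C => h1 ⟨n, (W, x)⟩ i C) (fun i C => h2 ⟨n, (W, x)⟩ i C)
  have hφC : ContDiffAt ℝ 2 φ (ρ θ) :=
    contDiffAt_log_transition hS (fun i C => hlo.trans_le (hθ ⟨n, (W, x)⟩ i C).1) D
  obtain ⟨hφ1, hφ2⟩ := hK n W D (ρ θ) fun i C => hθ ⟨n, (W, x)⟩ i C
  have heq : (fun θ' => logLik S rate θ' ⟨n, (W, x), y⟩) =ᶠ[𝓝 θ] φ ∘ ρ := by
    filter_upwards [hU] with θ' hθ'
    exact logLik_eq hS (fun z i C => hlo.trans_le (hb θ' hθ' z i C).1) _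
  have hK0 : 0 ≤ K := (norm_nonneg _).trans hφ1
  refine ⟨(hφC.comp θ hρC).congr_of_eventuallyEq heq, ?_, ?_⟩
  · rw [heq.fderiv_eq]
    exact (norm_fderiv_comp_le (hφC.differentiableAt (by norm_num))
      (hρC.differentiableAt (by norm_num))).trans (mul_le_mul hφ1 hρ1 (norm_nonneg _) hK0)
  · rw [heq.fderiv.fderiv_eq]
    exact (norm_fderiv_fderiv_comp_le hφC hρC).trans (add_le_add
      (mul_le_mul hφ2 (pow_le_pow_left₀ (norm_nonneg _) hρ1 2) (by positivity) hK0)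
      (mul_le_mul hφ1 hρ2 (norm_nonneg _) hK0))

lemma rateVector_hasFDerivAt {rate : RateFamily (EuclideanSpace ℝ (Fin d)) Nbar 𝒳}
    {θ : EuclideanSpace ℝ (Fin d)} {m : ℕ} (c : Fin m → RateIndex Nbar 𝒳)
    (h : ∀ z i C, DifferentiableAt ℝ (fun θ' => rate θ' z i C) θ) :
    ∃ L : EuclideanSpace ℝ (Fin d) →L[ℝ] EuclideanSpace ℝ (Fin m),
      HasFDerivAt (fun θ' => rateVector rate θ' c) L θ ∧
      ∀ v, (L v).ofLp = (rateJacobian rate θ c).mulVec v.ofLp := by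
  have hd : DifferentiableAt ℝ (fun θ' => rateVector rate θ' c) θ :=
    (differentiableAt_euclidean).2 fun a => h _ _ _
  refine ⟨_, hd.hasFDerivAt, fun v => ?_⟩
  ext a
  have h1 := ((EuclideanSpace.proj a : EuclideanSpace ℝ (Fin m) →L[ℝ] ℝ).hasFDerivAt.comp θ
    hd.hasFDerivAt).unique (h (c a).1 (c a).2.1 (c a).2.2).hasFDerivAt
  have h2 : fderiv ℝ (fun θ' => rateVector rate θ' c) θ v a =
      fderiv ℝ (fun θ' => rate θ' (c a).1 (c a).2.1 (c a).2.2) θ v := DFunLike.congr_fun h1 v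
  rw [h2, Matrix.mulVec]
  have h3 : fderiv ℝ (fun θ' => rate θ' (c a).1 (c a).2.1 (c a).2.2) θ v =
      inner ℝ (gradient (fun θ' => rate θ' (c a).1 (c a).2.1 (c a).2.2) θ) v := by
    simp [gradient]
  rw [h3, EuclideanSpace.real_inner_eq_dotProduct]
  rfl

end PeerEffects

end

/-! ### The asymptotic normality theorem. -/

theorem mainTheorem4
    {𝒳 : Type*} [MeasurableSpace 𝒳] {Nbar d : ℕ}
    -- observation time, law of the block characteristics `(N_b, W_b, X_b)`, family of rates
    (S : ℝ) (hS : 0 < S)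
    (𝒟 : Measure (PeerEffects.Block Nbar 𝒳)) [IsProbabilityMeasure 𝒟]
    (rate : PeerEffects.RateFamily (EuclideanSpace ℝ (Fin d)) Nbar 𝒳)
    -- compact parameter space with the true parameter in its interior
    (Θ : Set (EuclideanSpace ℝ (Fin d))) (hΘ : IsCompact Θ)
    (θ₀ : EuclideanSpace ℝ (Fin d)) (hθ₀ : θ₀ ∈ interior Θ)
    -- the rates stay in a compact subset of `(0, ∞)`
    (lo hi : ℝ) (hlo : 0 < lo)
    (hbound : ∀ θ ∈ Θ, ∀ z i C, rate θ z i C ∈ Set.Icc lo hi)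
    -- regularity of the rates in the covariates and in the parameter
    (hmeas : ∀ θ ∈ Θ, ∀ (n : Fin Nbar) (W : Fin n → Fin n → Bool) (i : Fin n)
      (C : Finset (Fin n)), Measurable fun x : Fin n → 𝒳 => rate θ ⟨n, (W, x)⟩ i C)
    (hcont : ∀ z i C, ContinuousOn (fun θ => rate θ z i C) Θ)
    (hsmooth : ∃ V ∈ 𝓝 θ₀, ∃ M : ℝ, ∀ θ ∈ V, ∀ z i C,
      ContDiffAt ℝ 2 (fun θ' => rate θ' z i C) θ ∧
      ∀ k : ℕ, k ≤ 2 → ‖iteratedFDeriv ℝ k (fun θ' => rate θ' z i C) θ‖ ≤ M)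
    -- identification
    (hident : ∀ θ ∈ Θ,
      PeerEffects.modelLaw S rate 𝒟 θ = PeerEffects.modelLaw S rate 𝒟 θ₀ → θ = θ₀)
    -- the expected outer product of the score is nonsingular
    (hinfo : IsUnit (PeerEffects.scoreOuter S rate 𝒟 θ₀).det)
    -- independent blocks generated by the process at the true parameter
    {Ω : Type*} [MeasurableSpace Ω] (μ : Measure Ω) [IsProbabilityMeasure μ]
    (D : ℕ → Ω → PeerEffects.BlockObs Nbar 𝒳) (hD : ∀ b, Measurable (D b))
    (hindep : iIndepFun D μ)
    (hlaw : ∀ b, μ.map (D b) = PeerEffects.modelLaw S rate 𝒟 θ₀)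
    -- the maximum likelihood estimator from the first `B` blocks
    (θhat : ℕ → Ω → EuclideanSpace ℝ (Fin d)) (hθhat : ∀ B, AEMeasurable (θhat B) μ)
    (hMLE : ∀ B, ∀ᵐ ω ∂μ, PeerEffects.IsMLE S rate Θ (fun b => D b ω) B (θhat B ω)) :
    -- the score exists, and its outer product has a finite, positive definite expectation
    (∀ o, DifferentiableAt ℝ (fun θ => PeerEffects.logLik S rate θ o) θ₀) ∧
    (∀ i j, Integrable
      (fun o => PeerEffects.score S rate θ₀ o i * PeerEffects.score S rate θ₀ o j)
      (PeerEffects.modelLaw S rate 𝒟 θ₀)) ∧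
    (PeerEffects.scoreOuter S rate 𝒟 θ₀).PosDef ∧
    -- asymptotic normality of the estimator
    TendstoInDistribution (fun (B : ℕ) ω => √(B : ℝ) • (θhat B ω - θ₀)) atTop id
      (fun _ => μ) (multivariateGaussian 0 (PeerEffects.scoreOuter S rate 𝒟 θ₀)⁻¹) ∧
    -- asymptotic normality of any finite list of estimated rates
    (∀ (m : ℕ) (c : Fin m → PeerEffects.RateIndex Nbar 𝒳),
      TendstoInDistribution
        (fun (B : ℕ) ω => √(B : ℝ) •
          (PeerEffects.rateVector rate (θhat B ω) c - PeerEffects.rateVector rate θ₀ c))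
        atTop id (fun _ => μ)
        (multivariateGaussian 0
          (PeerEffects.rateJacobian rate θ₀ c * (PeerEffects.scoreOuter S rate 𝒟 θ₀)⁻¹ *
            (PeerEffects.rateJacobian rate θ₀ c).transpose))) := by
  obtain ⟨V, hV, M, hVM⟩ := hsmooth
  have hθ₀Θ : θ₀ ∈ Θ := interior_subset hθ₀
  have hpos : ∀ θ ∈ Θ, ∀ z i C, 0 < rate θ z i C := fun θ hθ z i C =>
    hlo.trans_le (hbound θ hθ z i C).1
  obtain ⟨K, hK0, hK⟩ := PeerEffects.exists_bound_log_transition Nbar hS hlo hi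
  -- `M` may be negative when there is no rate to bound, as for `Nbar = 0`.
  set N := max M 0 with hN
  have hN0 : 0 ≤ N := le_max_right _ _
  set U := V ∩ interior Θ with hU
  have hUn : U ∈ 𝓝 θ₀ := inter_mem hV (isOpen_interior.mem_nhds hθ₀)
  have hder := fun θ (hθ : θ ∈ U) => PeerEffects.logLik_derivative_bounds (rate := rate) (θ := θ)
    hS hlo (isOpen_interior.mem_nhds hθ.2) (fun θ' hθ' => hbound θ' (interior_subset hθ')) hN0
    (fun z i C => (hVM θ hθ.1 z i C).1)
    (fun z i C => by
      rw [← norm_iteratedFDeriv_one]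
      exact ((hVM θ hθ.1 z i C).2 1 (by norm_num)).trans (le_max_left _ _))
    (fun z i C => by
      rw [← norm_iteratedFDeriv_one, norm_iteratedFDeriv_fderiv]
      exact ((hVM θ hθ.1 z i C).2 2 le_rfl).trans (le_max_left _ _))
    (fun n W D r hr => (hK n W D r hr).2)
  -- One constant for the log-likelihood, its gradient and its Hessian.
  set Q := max K (max (K * N) (K * N ^ 2 + K * N)) with hQ
  have hlm : ∀ θ ∈ Θ, Measurable (PeerEffects.logLik S rate θ) := fun θ hθ =>
    PeerEffects.measurable_logLik hS (hpos θ hθ) (hmeas θ hθ)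
  have hlb : ∀ θ ∈ Θ, ∀ o, ‖PeerEffects.logLik S rate θ o‖ ≤ Q := by
    intro θ hθ o
    rw [PeerEffects.logLik_eq hS (hpos θ hθ)]
    exact (hK o.1 o.2.1.1 _ _ fun i C => hbound θ hθ ⟨o.1, o.2.1⟩ i C).1.trans (le_max_left _ _)
  have hlc : ∀ o, ContinuousOn (fun θ => PeerEffects.logLik S rate θ o) Θ := by
    rintro ⟨n, ⟨W, x⟩, y⟩
    let ρ : EuclideanSpace ℝ (Fin d) → Fin n → Finset (Fin n) → ℝ := fun θ => rate θ ⟨n, (W, x)⟩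
    have hρ : ContinuousOn ρ Θ :=
      continuousOn_pi.2 fun i => continuousOn_pi.2 fun C => hcont ⟨n, (W, x)⟩ i C
    refine ContinuousOn.congr (f := fun θ => Real.log (PeerEffects.transition W S ∅
      (Finset.univ.filter fun i => y i = true) (ρ θ))) (fun θ hθ => ?_)
      fun θ hθ => PeerEffects.logLik_eq hS (hpos θ hθ) _
    have hφ := PeerEffects.contDiffAt_log_transition (W := W) hS (hpos θ hθ ⟨n, (W, x)⟩)
      (Finset.univ.filter fun i => y i = true)
    exact hφ.continuousAt.comp_continuousWithinAt (hρ θ hθ)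
  have hmax : ∀ θ ∈ Θ, θ ≠ θ₀ →
      ∫ o, PeerEffects.logLik S rate θ o ∂(PeerEffects.modelLaw S rate 𝒟 θ₀) <
        ∫ o, PeerEffects.logLik S rate θ₀ o ∂(PeerEffects.modelLaw S rate 𝒟 θ₀) :=
    fun θ hθ hne => PeerEffects.integral_logLik_lt hS (hpos θ₀ hθ₀Θ) (hpos θ hθ) (hlm θ₀ hθ₀Θ)
      (hlm θ hθ) (hlb θ₀ hθ₀Θ) (hlb θ hθ) fun h => hne (hident θ hθ h)
  have hθ₀U : θ₀ ∈ U := mem_of_mem_nhds hUn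
  -- Conditionally on the block the outcomes are finite in number, so the Bartlett identities need
  -- no differentiation under an integral.
  have hbart : ∀ z : PeerEffects.Block Nbar 𝒳, _ := fun z => bartlett_identities
    (f := fun (y : Fin z.1 → Bool) θ => PeerEffects.logLik S rate θ ⟨z.1, (z.2, y)⟩)
    (fun y => (hder θ₀ hθ₀U ⟨z.1, (z.2, y)⟩).1) (by
      filter_upwards [isOpen_interior.mem_nhds hθ₀] with θ hθ
      exact PeerEffects.sum_exp_logLik hS (hpos θ (interior_subset hθ)) z)
  have hprob : IsProbabilityMeasure (PeerEffects.modelLaw S rate 𝒟 θ₀) :=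
    PeerEffects.isProbabilityMeasure_modelLaw hS (hpos θ₀ hθ₀Θ) (hlm θ₀ hθ₀Θ)
  have hm1 : ∀ θ ∈ interior U, Measurable fun o =>
      fderiv ℝ (fun θ => PeerEffects.logLik S rate θ o) θ := fun θ hθ => by
    have hθU : θ ∈ U := interior_subset hθ
    refine measurable_fderiv_of_eventually ?_
      fun o => (hder θ hθU o).1.differentiableAt (by norm_num)
    filter_upwards [isOpen_interior.mem_nhds hθU.2] with y hy
    exact hlm y (interior_subset hy)
  have hθ₀I : θ₀ ∈ interior U := mem_interior_iff_mem_nhds.2 hUn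
  have hm1v : ∀ v, Measurable fun o =>
      fderiv ℝ (fun θ => PeerEffects.logLik S rate θ o) θ₀ v := fun v =>
    (ContinuousLinearMap.measurable_apply v).comp (hm1 θ₀ hθ₀I)
  have hm2v : ∀ v w, Measurable fun o =>
      fderiv ℝ (fderiv ℝ fun θ => PeerEffects.logLik S rate θ o) θ₀ v w := fun v w => by
    have h : Measurable fun o =>
        fderiv ℝ (fderiv ℝ fun θ => PeerEffects.logLik S rate θ o) θ₀ := by
      refine measurable_fderiv_of_eventually
        (f := fun θ o => fderiv ℝ (fun θ => PeerEffects.logLik S rate θ o) θ) ?_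
        fun o => (hder θ₀ hθ₀U o).1.differentiableAt_fderiv
      filter_upwards [isOpen_interior.mem_nhds hθ₀I] with y hy
      exact hm1 y hy
    exact (ContinuousLinearMap.measurable_apply w).comp
      ((ContinuousLinearMap.measurable_apply v).comp h)
  have hb1v : ∀ v o, ‖fderiv ℝ (fun θ => PeerEffects.logLik S rate θ o) θ₀ v‖ ≤ K * N * ‖v‖ :=
    fun v o => (ContinuousLinearMap.le_opNorm _ _).trans
      (mul_le_mul_of_nonneg_right (hder θ₀ hθ₀U o).2.1 (norm_nonneg _))
  have hscore : ∀ v, ∫ o, fderiv ℝ (fun θ => PeerEffects.logLik S rate θ o) θ₀ v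
      ∂(PeerEffects.modelLaw S rate 𝒟 θ₀) = 0 := fun v => by
    rw [PeerEffects.integral_modelLaw hS (hpos θ₀ hθ₀Θ) (hlm θ₀ hθ₀Θ) (hm1v v)
      (Integrable.of_bound (hm1v v).aestronglyMeasurable _ (ae_of_all _ (hb1v v)))]
    exact (integral_congr_ae (ae_of_all _ fun z => (hbart z).1 v)).trans (integral_zero _ _)
  have hinf : ∀ v w, ∫ o, (fderiv ℝ (fderiv ℝ fun θ => PeerEffects.logLik S rate θ o) θ₀ v w +
      fderiv ℝ (fun θ => PeerEffects.logLik S rate θ o) θ₀ v *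
        fderiv ℝ (fun θ => PeerEffects.logLik S rate θ o) θ₀ w)
      ∂(PeerEffects.modelLaw S rate 𝒟 θ₀) = 0 := fun v w => by
    have hm : Measurable fun o =>
        fderiv ℝ (fderiv ℝ fun θ => PeerEffects.logLik S rate θ o) θ₀ v w +
          fderiv ℝ (fun θ => PeerEffects.logLik S rate θ o) θ₀ v *
            fderiv ℝ (fun θ => PeerEffects.logLik S rate θ o) θ₀ w :=
      (hm2v v w).add ((hm1v v).mul (hm1v w))
    rw [PeerEffects.integral_modelLaw hS (hpos θ₀ hθ₀Θ) (hlm θ₀ hθ₀Θ) hm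
      (Integrable.of_bound hm.aestronglyMeasurable
        ((K * N ^ 2 + K * N) * ‖v‖ * ‖w‖ + K * N * ‖v‖ * (K * N * ‖w‖)) (ae_of_all _ fun o => ?_))]
    · exact (integral_congr_ae (ae_of_all _ fun z => (hbart z).2 v w)).trans (integral_zero _ _)
    · refine (norm_add_le _ _).trans (add_le_add ?_ ?_)
      · exact (ContinuousLinearMap.le_opNorm₂ _ _ _).trans (mul_le_mul_of_nonneg_right
          (mul_le_mul_of_nonneg_right (hder θ₀ hθ₀U o).2.2 (norm_nonneg _)) (norm_nonneg _))
      · rw [norm_mul]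
        exact mul_le_mul (hb1v v o) (hb1v w o) (norm_nonneg _) (by positivity)
  have hcons := ae_tendsto_maximum_likelihood hΘ hθ₀Θ hlm hlc hlb hmax hD hindep hlaw hMLE
  obtain ⟨hint, hpd, hnorm⟩ := tendstoInDistribution_maximum_likelihood (M := Q) hΘ hθ₀ hlm hlc hlb
    hUn (fun θ hθ o => (hder θ hθ o).1)
    (fun θ hθ o => (hder θ hθ o).2.1.trans ((le_max_left _ _).trans (le_max_right _ _)))
    (fun θ hθ o => (hder θ hθ o).2.2.trans ((le_max_right _ _).trans (le_max_right _ _)))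
    hmax hscore hinf (J := PeerEffects.scoreOuter S rate 𝒟 θ₀) (fun i j => rfl) hinfo hD hindep
    hlaw hθhat hMLE
  refine ⟨fun o => (hder θ₀ hθ₀U o).1.differentiableAt (by norm_num), hint, hpd, hnorm,
    fun m c => ?_⟩
  obtain ⟨L, hL, hLv⟩ := PeerEffects.rateVector_hasFDerivAt (rate := rate) (θ := θ₀) c
    fun z i C => (hVM θ₀ hθ₀U.1 z i C).1.differentiableAt (by norm_num)
  have hrc : ContinuousOn (fun θ => PeerEffects.rateVector rate θ c) Θ :=
    (PiLp.continuous_toLp 2 _).comp_continuousOn (continuousOn_pi.2 fun a => hcont _ _ _)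
  -- The derivative of the rates is `G`, and the image of N(0, J⁻¹) under it has covariance G J⁻¹
  -- Gᵀ.
  refine (hnorm.delta_method hcons hL fun B => AEMeasurable.continuousOn_comp hΘ.measurableSet hrc
    (hθhat B) ((hMLE B).mono fun ω hω => hω.1)).of_map_eq ?_
  rw [Function.comp_id]
  exact map_multivariateGaussian_zero hpd.inv.posSemidef _ L hLv
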